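/- Let $A,B$ be $\mathbb Z/2$-graded $C^*$-algebras, with grading automorphism $\gamma$ of $A$ (so $\gamma(a)=(-1)^{\partial a}a$ for homogeneous $a$). Let $E$ be a $\mathbb Z/2$-graded Hilbert $C^*$-module over $B$ with a graded $*$-homomorphism $\varphi:A\to\mathrm{End}^*_B(E)$ into the adjointable operators, and let $D$ be an odd selfadjoint regular operator in $E$ (for instance, let $(E,D)$ be an unbounded $KK$-cycle for $(A,B)$). Put $E_0=E$ and $E_{n+1}=E_n\oplus E_n$, so $E_n=E^{2^n}$ and $\mathrm{End}^*_B(E_n)=M_{2^n}(\mathrm{End}^*_B(E))$, and let $D$ act diagonally on $E_n$. For $n\ge 1$ let $$p_n=\begin{pmatrix}(1+D^2)^{-1}&D(1+D^2)^{-1}\\ D(1+D^2)^{-1}&D^2(1+D^2)^{-1}\end{pmatrix}$$ be the projection in $\mathrm{End}^*_B(E_{n-1}\oplus E_{n-1})$ onto the graph of $D$ on $E_{n-1}$; on $E_{n+1}=E_n\oplus E_n$ we also write $p_n$ for $p_n\oplus p_n$. Put $p^\perp=1-p$. Define $\mathcal A_0=A$, $\pi_0=\theta_0=\varphi$ and,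 inductively for $n\ge 0$, $$\mathcal A_{n+1}=\{a\in\mathcal A_n : [D,\theta_n(a)]\in \mathrm{End}^*_B(E_n)\},$$ $$\pi_{n+1}(a)=\begin{pmatrix}\theta_n(a)&0\\ [D,\theta_n(a)]&\theta_n(\gamma(a))\end{pmatrix}\in\mathrm{End}^*_B(E_{n+1}),$$ $$\theta_1(a)=p_1\pi_1(a)p_1+p_1^\perp\pi_1(a)p_1^\perp,$$ $$\theta_{n+1}(a)=p_{n+1}p_n\pi_{n+1}(a)p_np_{n+1}+p_{n+1}^\perp p_n^\perp\pi_{n+1}(a)p_n^\perp p_{n+1}^\perp\quad(n\ge1).$$ Here $[D,\theta_n(a)]=D\theta_n(a)-\theta_n(\gamma(a))D$ is the graded commutator, and the condition $[D,\theta_n(a)]\in\mathrm{End}^*_B(E_n)$ means that $\theta_n(a)$ preserves the domain of $D$ and that the commutator, defined on that domain, extends to an adjointable operator. Then for every $n\ge 0$ the $n$-th Sobolev subalgebra $\mathcal A_n$ is a $*$-subalgebra of $A$, and $\rho_n=\bigoplus_{j=0}^n\pi_j$ is an algebra homomorphism (in general not a $*$-homomorphism) from $\mathcal A_n$ into the $C^*$-algebra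 $\bigoplus_{j=0}^n\mathrm{End}^*_B(E_j)$. For the matrix norms $\|(a_{ij})\|_n=\|(\rho_n(a_{ij}))\|$, the involution of $\mathcal A_n$ is a complete anti-isometry: $$\|(a_{ji}^*)_{ij}\|_n=\|(a_{ij})_{ij}\|_n\qquad\text{for all } N \text{ and all }(a_{ij})\in M_N(\mathcal A_n).$$ Consequently, if $\varphi$ is injective, so that $A$ is a $C^*$-algebra of operators on $E$, then $\mathcal A_n$ is an involutive operator algebra: $\rho_n$ is injective with closed range (so $\mathcal A_n$ is an operator space), the multiplication $\mathcal A_n\otimes\mathcal A_n\to\mathcal A_n$ is completely contractive for the Haagerup tensor norms, and the involution $(a_{ij})\mapsto(a_{ji}^*)$ is completely bounded. -/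

import Mathlib

open scoped TensorProduct

noncomputable section

/-! ### Adjointable operators on a Hilbert C⋆-module -/

section Adjointable

variable (B E : Type*) [NonUnitalCStarAlgebra B] [PartialOrder B] [StarOrderedRing B]
  [NormedAddCommGroup E] [NormedSpace ℂ E] [SMul B E] [CStarModule B E]

/-- The algebra `End*_B(E)` of adjointable operators, as a subalgebra of the bounded operators on
`E`; its norm is the operator norm. -/
def Adjointable : Subalgebra ℂ (E →L[ℂ] E) where
  carrier := {T | ∃ S : E →L[ℂ] E, ∀ x y, inner B (T x) y = inner B x (S y)}
  mul_mem' := by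
    rintro T T' ⟨S, hS⟩ ⟨S', hS'⟩
    exact ⟨S' * S, fun x y => by simp [hS, hS']⟩
  add_mem' := by
    rintro T T' ⟨S, hS⟩ ⟨S', hS'⟩
    exact ⟨S + S', fun x y => by simp [hS, hS']⟩
  algebraMap_mem' := fun c =>
    ⟨algebraMap ℂ _ (star c), fun x y => by simp [Algebra.algebraMap_eq_smul_one]⟩

namespace Adjointable

variable {B E}
set_option linter.unusedSectionVars false

theorem ext_inner {x y : E} (h : ∀ z, inner B z x = inner B z y) : x = y := by
  rw [← sub_eq_zero, ← CStarModule.inner_self (A := B), CStarModule.inner_sub_right, h, sub_self]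

/-- The adjoint `T*` of an adjointable operator. -/
instance : Star (Adjointable B E) where
  star T := ⟨T.2.choose, T.1, fun x y => by
    rw [← CStarModule.star_inner, ← T.2.choose_spec, CStarModule.star_inner]⟩

theorem inner_star_right (T : Adjointable B E) (x y : E) :
    inner B x ((star T).1 y) = inner B (T.1 x) y :=
  (T.2.choose_spec x y).symm

theorem inner_star_left (T : Adjointable B E) (x y : E) :
    inner B ((star T).1 x) y = inner B x (T.1 y) := by
  rw [← CStarModule.star_inner, inner_star_right, CStarModule.star_inner]

theorem ext_op {S T : Adjointable B E} (h : ∀ x y, inner B x (S.1 y) = inner B x (T.1 y)) :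
    S = T :=
  Subtype.ext (ContinuousLinearMap.ext fun y => ext_inner (B := B) fun x => h x y)

instance : StarRing (Adjointable B E) where
  star_involutive T := ext_op fun x y => by rw [inner_star_right, inner_star_left]
  star_mul S T := ext_op fun x y => by
    rw [inner_star_right]
    change inner B (S.1 (T.1 x)) y = inner B x ((star T).1 ((star S).1 y))
    rw [inner_star_right, inner_star_right]
  star_add S T := ext_op fun x y => by
    rw [inner_star_right]
    change inner B (S.1 x + T.1 x) y = inner B x ((star S).1 y + (star T).1 y)
    rw [CStarModule.inner_add_left, CStarModule.inner_add_right, inner_star_right,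
      inner_star_right]

instance : StarModule ℂ (Adjointable B E) where
  star_smul c T := ext_op fun x y => by
    rw [inner_star_right]
    change inner B (c • T.1 x) y = inner B x (star c • (star T).1 y)
    rw [CStarModule.inner_smul_left_complex, CStarModule.inner_smul_right_complex,
      inner_star_right]

theorem norm_sq_le (T : Adjointable B E) : ‖T‖ * ‖T‖ ≤ ‖star T * T‖ := by
  have h : ‖T.1‖ ≤ √‖(star T * T).1‖ := by
    refine ContinuousLinearMap.opNorm_le_bound _ (Real.sqrt_nonneg _) fun x => ?_
    rw [CStarModule.norm_eq_sqrt_norm_inner_self (A := B) (T.1 x), ← inner_star_right]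
    refine Real.sqrt_le_iff.2 ⟨by positivity, ?_⟩
    rw [mul_pow, Real.sq_sqrt (norm_nonneg _)]
    calc _ ≤ ‖x‖ * ‖(star T * T).1 x‖ := CStarModule.norm_inner_le E
      _ ≤ ‖x‖ * (‖(star T * T).1‖ * ‖x‖) := by gcongr; exact ContinuousLinearMap.le_opNorm _ _
      _ = _ := by ring
  have h2 := mul_self_le_mul_self (norm_nonneg _) h
  rwa [Real.mul_self_sqrt (norm_nonneg _)] at h2

instance : CStarRing (Adjointable B E) where
  norm_mul_self_le T := norm_sq_le T

instance [CompleteSpace E] : CompleteSpace (Adjointable B E) := by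
  have hst : ∀ T : Adjointable B E, ‖star T‖ = ‖T‖ := fun T => norm_star T
  refine Metric.complete_of_cauchySeq_tendsto fun u hu => ?_
  have hsu : CauchySeq fun n => star (u n) := by
    rw [Metric.cauchySeq_iff] at hu ⊢
    intro ε hε
    obtain ⟨N, hN⟩ := hu ε hε
    refine ⟨N, fun m hm n hn => ?_⟩
    have h : dist (star (u m)) (star (u n)) = dist (u m) (u n) := by
      rw [dist_eq_norm, dist_eq_norm]
      exact (congrArg norm (star_sub (u m) (u n)).symm).trans (hst _)
    rw [h]
    exact hN m hm n hn
  obtain ⟨T, hT⟩ := cauchySeq_tendsto_of_complete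
    (uniformContinuous_subtype_val.comp_cauchySeq hu)
  obtain ⟨S, hS⟩ := cauchySeq_tendsto_of_complete
    (uniformContinuous_subtype_val.comp_cauchySeq hsu)
  have happ : ∀ {v : ℕ → E →L[ℂ] E} {V : E →L[ℂ] E}, Filter.Tendsto v Filter.atTop (nhds V) →
      ∀ x, Filter.Tendsto (fun n => v n x) Filter.atTop (nhds (V x)) := fun hv x =>
    ((ContinuousLinearMap.apply ℂ E x).continuous.tendsto _).comp hv
  refine ⟨⟨T, S, fun x y => ?_⟩, tendsto_subtype_rng.2 hT⟩
  have hc : Continuous fun p : E × E => inner B p.1 p.2 := CStarModule.continuous_inner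
  have h1 : Filter.Tendsto (fun n => inner B ((u n).1 x) y) Filter.atTop
      (nhds (inner B (T x) y)) :=
    (hc.tendsto (T x, y)).comp ((happ hT x).prodMk_nhds tendsto_const_nhds)
  have h2 : Filter.Tendsto (fun n => inner B x ((star (u n)).1 y)) Filter.atTop
      (nhds (inner B x (S y))) :=
    (hc.tendsto (x, S y)).comp (tendsto_const_nhds.prodMk_nhds (happ hS y))
  simp only [inner_star_right] at h2
  exact tendsto_nhds_unique h1 h2

instance [CompleteSpace E] : CStarAlgebra (Adjointable B E) where

instance [CompleteSpace E] : PartialOrder (Adjointable B E) := CStarAlgebra.spectralOrder _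

instance [CompleteSpace E] : StarOrderedRing (Adjointable B E) :=
  CStarAlgebra.spectralOrderedRing _

end Adjointable

end Adjointable

/-! ### Operator spaces and operator algebras -/

section OperatorSpaces

variable {V C : Type*} [NonUnitalCStarAlgebra C]

/-- The C⋆-norm of an `m × n` matrix over the C⋆-algebra `C`. -/
def cstarMatrixNorm {m n : Type} [Fintype m] [Fintype n] (M : Matrix m n C) : ℝ :=
  letI : PartialOrder C := CStarAlgebra.spectralOrder C
  letI : StarOrderedRing C := CStarAlgebra.spectralOrderedRing C
  ‖CStarMatrix.ofMatrix M‖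

/-- The matrix norms which a map `ρ : V → C` into a C⋆-algebra induces on the matrices over `V`. -/
def opNorm (ρ : V → C) {m n : Type} [Fintype m] [Fintype n] (x : Matrix m n V) : ℝ :=
  cstarMatrixNorm (x.map ρ)

/-- `ρ` realizes `V` as an operator space, that is, as a closed subspace of the C⋆-algebra `C`. -/
def IsOperatorSpace [AddCommGroup V] [Module ℂ V] (ρ : V →ₗ[ℂ] C) : Prop :=
  Function.Injective ρ ∧ IsClosed (Set.range ρ)

/-- The Haagerup norms on the matrices over the algebraic tensor product `V ⊗ V`:
`‖z‖ = inf {‖x‖ ‖y‖ : z_ij = ∑ₖ x_ik ⊗ y_kj}`, over all factorizations of `z` by an `N × r` matrix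
`x` and an `r × N` matrix `y` over `V`. For `N = 1` this is
`inf {‖∑ xₖ xₖ*‖^(1/2) ‖∑ yₖ* yₖ‖^(1/2) : z = ∑ xₖ ⊗ yₖ}`. The Haagerup tensor product is the
completion. -/
def haagerupNorm [AddCommGroup V] [Module ℂ V] (ρ : V →ₗ[ℂ] C) {N : ℕ}
    (z : Matrix (Fin N) (Fin N) (V ⊗[ℂ] V)) : ℝ :=
  sInf {c | ∃ (r : ℕ) (x : Matrix (Fin N) (Fin r) V) (y : Matrix (Fin r) (Fin N) V),
    (∀ i j, z i j = ∑ k, x i k ⊗ₜ[ℂ] y k j) ∧ c = opNorm ρ x * opNorm ρ y}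

/-- With the operator space structure given by `ρ`, the algebra `V` is an operator algebra: its
multiplication is completely contractive for the Haagerup norms. -/
def IsOperatorAlgebra [NonUnitalRing V] [Module ℂ V] [IsScalarTower ℂ V V] [SMulCommClass ℂ V V]
    (ρ : V →ₗ[ℂ] C) : Prop :=
  IsOperatorSpace ρ ∧ ∀ (N : ℕ) (z : Matrix (Fin N) (Fin N) (V ⊗[ℂ] V)),
    opNorm ρ (z.map (LinearMap.mul' ℂ V)) ≤ haagerupNorm ρ z

/-- The involution is a complete anti-isometry: `‖(a_ji*)_ij‖ = ‖(a_ij)_ij‖` for all square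
matrices over `V`. -/
def IsCompleteAntiIsometry [Star V] (ρ : V → C) : Prop :=
  ∀ (N : ℕ) (x : Matrix (Fin N) (Fin N) V), opNorm ρ x.conjTranspose = opNorm ρ x

/-- `V` is an operator algebra with a completely bounded involution; the involution, which reverses
products, acts on matrices by `(a_ij) ↦ (a_ji*)`. -/
def IsInvolutiveOperatorAlgebra [NonUnitalRing V] [StarRing V] [Module ℂ V] [StarModule ℂ V]
    [IsScalarTower ℂ V V] [SMulCommClass ℂ V V] (ρ : V →ₗ[ℂ] C) : Prop :=
  IsOperatorAlgebra ρ ∧ ∃ K : ℝ, ∀ (N : ℕ) (x : Matrix (Fin N) (Fin N) V),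
    opNorm ρ x.conjTranspose ≤ K * opNorm ρ x

end OperatorSpaces

/-! ### Selfadjoint regular operators -/

section Regular

variable (B : Type*) {E : Type*} [NonUnitalCStarAlgebra B] [PartialOrder B] [StarOrderedRing B]
  [NormedAddCommGroup E] [NormedSpace ℂ E] [SMul B E] [CStarModule B E]

/-- `y ∈ Dom D*` and `D* y = z`. -/
def IsAdjointValue (D : E →ₗ.[ℂ] E) (y z : E) : Prop :=
  ∀ x : D.domain, inner B (D x) y = inner B (x : E) z

/-- `D` is a regular operator: closed and densely defined, with `D*` densely defined, and such that
`1 + D* D` has dense range. -/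
def IsRegularOp (D : E →ₗ.[ℂ] E) : Prop :=
  Dense (D.domain : Set E) ∧ D.IsClosed ∧ Dense {y : E | ∃ z, IsAdjointValue B D y z} ∧
    Dense {w : E | ∃ (x : D.domain) (z : E), IsAdjointValue B D (D x) z ∧ (x : E) + z = w}

/-- `D` is symmetric on its domain, and `Dom D* = Dom D`. -/
def IsSelfAdjointOp (D : E →ₗ.[ℂ] E) : Prop :=
  (∀ x y : D.domain, inner B (D x) (y : E) = inner B (x : E) (D y)) ∧
    {y : E | ∃ z, IsAdjointValue B D y z} = D.domain

/-- `R = (1 + D²)⁻¹`: for all `e`, `R e` is in `Dom D²` and `R e + D² R e = e`. -/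
def IsResolvent (D : E →ₗ.[ℂ] E) (R : Adjointable B E) : Prop :=
  ∀ e : E, ∃ (h₁ : R.1 e ∈ D.domain) (h₂ : D ⟨R.1 e, h₁⟩ ∈ D.domain),
    R.1 e + D ⟨D ⟨R.1 e, h₁⟩, h₂⟩ = e

/-- The operator `(1 + D²)⁻¹` in `End*_B(E)`. -/
def resolventOp (D : E →ₗ.[ℂ] E) : Adjointable B E :=
  Classical.epsilon (IsResolvent B D)

variable {B}

/-- The product `D T` in `End*_B(E)`, when `T` maps `E` into `Dom D` and `D T` is adjointable. -/
def leftComp (D : E →ₗ.[ℂ] E) (T : Adjointable B E) : Adjointable B E :=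
  Classical.epsilon fun S : Adjointable B E =>
    ∀ e : E, ∃ h : T.1 e ∈ D.domain, D ⟨T.1 e, h⟩ = S.1 e

/-- `T` preserves `Dom D`, and `D T - T' D` is the restriction of `S` to `Dom D`. -/
def IsTwistedCommutator (D : E →ₗ.[ℂ] E) (T T' S : Adjointable B E) : Prop :=
  ∀ x : D.domain, ∃ h : T.1 x ∈ D.domain, D ⟨T.1 x, h⟩ - T'.1 (D x) = S.1 x

/-- For operators on `E^ι` in matrix form, with `D` acting diagonally on `E^ι`:
`D T - T' D` extends to an element of `End*_B(E^ι) = M_ι(End*_B(E))`. -/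
def HasTwistedCommutator {ι : Type} (D : E →ₗ.[ℂ] E) (T T' : Matrix ι ι (Adjointable B E)) : Prop :=
  ∃ S : Matrix ι ι (Adjointable B E), ∀ i j, IsTwistedCommutator D (T i j) (T' i j) (S i j)

/-- The extension of `D T - T' D` to `E^ι` (unique, as `D` is densely defined). -/
def twistedCommutator {ι : Type} (D : E →ₗ.[ℂ] E) (T T' : Matrix ι ι (Adjointable B E)) :
    Matrix ι ι (Adjointable B E) :=
  Classical.epsilon fun S : Matrix ι ι (Adjointable B E) =>
    ∀ i j, IsTwistedCommutator D (T i j) (T' i j) (S i j)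

end Regular

/-! ### The Sobolev subalgebras -/

/-- A `ℤ/2`-graded `(A, B)`-bimodule `E` with an odd selfadjoint regular operator `D`.
Mathlib writes the action of `B` on a Hilbert C⋆-module on the left, with
`⟪x, b • y⟫ = b * ⟪x, y⟫`; the modules `E` with a right action and `⟪x, y b⟫ = ⟪x, y⟫ b` are those
over the opposite C⋆-algebra. That `D` is `B`-linear follows from its selfadjointness. -/
structure UnboundedBimodule (A B E : Type*) [NonUnitalCStarAlgebra A] [NonUnitalCStarAlgebra B]
    [PartialOrder B] [StarOrderedRing B] [NormedAddCommGroup E] [NormedSpace ℂ E] [CompleteSpace E]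
    [SMul B E] [CStarModule B E] where
  /-- the grading automorphism of `A`, `a ↦ (-1)^∂a a` on homogeneous elements -/
  gradA : A ≃⋆ₐ[ℂ] A
  gradA_gradA : ∀ a, gradA (gradA a) = a
  /-- the grading automorphism of `B` -/
  gradB : B ≃⋆ₐ[ℂ] B
  gradB_gradB : ∀ b, gradB (gradB b) = b
  /-- the grading operator of `E` -/
  gradE : E →ₗ[ℂ] E
  gradE_gradE : ∀ e, gradE (gradE e) = e
  gradE_smul : ∀ (b : B) (e : E), gradE (b • e) = gradB b • gradE e
  inner_gradE : ∀ e f : E, inner B (gradE e) (gradE f) = gradB (inner B e f)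
  /-- the action of `A` on `E` -/
  φ : A →⋆ₙₐ[ℂ] Adjointable B E
  φ_gradA : ∀ (a : A) (e : E), (φ (gradA a)).1 e = gradE ((φ a).1 (gradE e))
  /-- the unbounded operator -/
  D : E →ₗ.[ℂ] E
  regular : IsRegularOp B D
  selfAdjoint : IsSelfAdjointOp B D
  odd : ∀ x : D.domain, ∃ h : gradE x ∈ D.domain, D ⟨gradE x, h⟩ = -gradE (D x)

/-- The index set, with `2^n` elements, of the coordinates of `E_n = E^(2^n)`, where
`E_{n+1} = E_n ⊕ E_n`. -/
def SobIdx : ℕ → Type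
  | 0 => Unit
  | n + 1 => SobIdx n ⊕ SobIdx n

instance SobIdx.instFintype : (n : ℕ) → Fintype (SobIdx n)
  | 0 => inferInstanceAs (Fintype Unit)
  | n + 1 =>
    letI := SobIdx.instFintype n
    inferInstanceAs (Fintype (SobIdx n ⊕ SobIdx n))

instance SobIdx.instDecidableEq : (n : ℕ) → DecidableEq (SobIdx n)
  | 0 => inferInstanceAs (DecidableEq Unit)
  | n + 1 =>
    letI := SobIdx.instDecidableEq n
    inferInstanceAs (DecidableEq (SobIdx n ⊕ SobIdx n))

namespace UnboundedBimodule

variable {A B E : Type*} [NonUnitalCStarAlgebra A] [NonUnitalCStarAlgebra B]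
  [PartialOrder B] [StarOrderedRing B] [NormedAddCommGroup E] [NormedSpace ℂ E] [CompleteSpace E]
  [SMul B E] [CStarModule B E] (X : UnboundedBimodule A B E)

/-- `R = (1 + D²)⁻¹`. -/
def res : Adjointable B E := resolventOp B X.D

/-- The Woronowicz projection `p_{n+1}` on `E_{n+1} = E_n ⊕ E_n`, of the operator `D` acting
diagonally on `E_n`: the block matrix with rows `(1 + D²)⁻¹, D (1 + D²)⁻¹` and
`D (1 + D²)⁻¹, D² (1 + D²)⁻¹`. -/
def woronowicz (n : ℕ) : Matrix (SobIdx (n + 1)) (SobIdx (n + 1)) (Adjointable B E) :=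
  Matrix.fromBlocks
    (Matrix.diagonal fun _ => X.res)
    (Matrix.diagonal fun _ => leftComp X.D X.res)
    (Matrix.diagonal fun _ => leftComp X.D X.res)
    (Matrix.diagonal fun _ => leftComp X.D (leftComp X.D X.res))

/-- The extension `p_{n+1} ⊕ p_{n+1}` of `p_{n+1}` to `E_{n+2} = E_{n+1} ⊕ E_{n+1}`. -/
def woronowiczExt (n : ℕ) : Matrix (SobIdx (n + 2)) (SobIdx (n + 2)) (Adjointable B E) :=
  Matrix.fromBlocks (X.woronowicz n) 0 0 (X.woronowicz n)

/-- The block matrix with rows `θ(a), 0` and `[D, θ(a)], (-1)^∂a θ(a)`, where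
`[D, θ(a)] = D θ(a) - (-1)^∂a θ(a) D`. -/
def piStep {n : ℕ} (θ : A → Matrix (SobIdx n) (SobIdx n) (Adjointable B E)) (a : A) :
    Matrix (SobIdx (n + 1)) (SobIdx (n + 1)) (Adjointable B E) :=
  Matrix.fromBlocks (θ a) 0 (twistedCommutator X.D (θ a) (θ (X.gradA a))) (θ (X.gradA a))

/-- The maps `θ_n : A_n → End*_B(E_n)`: with `p = p_{n+1}` and `q = p_n ⊕ p_n`,
`θ_0(a) = a`, `θ_1(a) = p π_1(a) p + p^⊥ π_1(a) p^⊥`, and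
`θ_{n+1}(a) = p q π_{n+1}(a) q p + p^⊥ q^⊥ π_{n+1}(a) q^⊥ p^⊥` for `n ≥ 1`.
The range of `p_n ⋯ p_1` on `E_n` is the graph of `D_n` (values outside `A_n` are irrelevant). -/
def theta : (n : ℕ) → A → Matrix (SobIdx n) (SobIdx n) (Adjointable B E)
  | 0, a => fun _ _ => X.φ a
  | 1, a =>
    X.woronowicz 0 * X.piStep (theta 0) a * X.woronowicz 0 +
      (1 - X.woronowicz 0) * X.piStep (theta 0) a * (1 - X.woronowicz 0)
  | n + 2, a =>
    X.woronowicz (n + 1) * X.woronowiczExt n * X.piStep (theta (n + 1)) a *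
        X.woronowiczExt n * X.woronowicz (n + 1) +
      (1 - X.woronowicz (n + 1)) * (1 - X.woronowiczExt n) * X.piStep (theta (n + 1)) a *
        (1 - X.woronowiczExt n) * (1 - X.woronowicz (n + 1))

/-- The representations `π_n` of `A_n` on `E_n`, where `π_0` is the given representation. -/
def rep : (n : ℕ) → A → Matrix (SobIdx n) (SobIdx n) (Adjointable B E)
  | 0 => X.theta 0
  | n + 1 => X.piStep (X.theta n)

/-- The Sobolev subalgebras: `A_0 = A`, and `A_{n+1}` is the set of all `a ∈ A_n` for which the
graded commutator `[D, θ_n(a)]` is an adjointable operator. -/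
def sobolev : ℕ → Set A
  | 0 => Set.univ
  | n + 1 => {a | a ∈ sobolev n ∧ HasTwistedCommutator X.D (X.theta n a) (X.theta n (X.gradA a))}

variable (B E) in
/-- The C⋆-algebra `⊕_{j ≤ n} End*_B(E_j) = ⊕_{j ≤ n} M_{2^j}(End*_B(E))`. -/
abbrev SobolevTarget (n : ℕ) : Type _ :=
  (j : Fin (n + 1)) → CStarMatrix (SobIdx j) (SobIdx j) (Adjointable B E)

/-- The direct sum `⊕_{j ≤ n} π_j`. -/
def sumRep (n : ℕ) (a : A) : SobolevTarget B E n :=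
  fun j => CStarMatrix.ofMatrix (X.rep j a)

end UnboundedBimodule

end

/-! The involution on `A_n` is implemented, up to adjoints, by an automorphism. There is an
injective `*`-endomorphism `Ψ_n` of `End*_B(E_n)` with `π_n(a*) = Ψ_n(π_n(a))*` for `a ∈ A_n`
(`isGradedRep_rep`). An injective `*`-homomorphism of C⋆-algebras is isometric at every matrix level
and so is the adjoint, hence the involution is a complete anti-isometry
(`isCompleteAntiIsometry_of_starHom`).

`Ψ_n` is built recursively along with the grading `Γ_n`. The adjoint of the lower triangular
`π_{n+1}(a)` is upper triangular, and exchanging the two copies of `E_n` makes it lower triangular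
again. Taking adjoints in `D θ(a) - θ(γ a) D = S` dictates `Ψ_{n+1}`: the flip, composed with `Ψ_n
Γ_n` on blocks, with off-diagonal sign `(-1)^n` (`commutator_star`). Here `Γ_n` sends `D` to `-D`
and `Ψ_n` sends `D` to `(-1)^n D` (`IsSymmetry`). With exactly these signs `Ψ_{n+1}` exchanges the
graph projection `p` and `1 - p` (`IsSymmetry.blockSwapHom_graphProj`), so it exchanges the two
summands of `θ_{n+1}`, and the relation `θ(a*) = Ψ(θ(a))*` passes to the next level.

Multiplicativity of `θ_{n+1}` holds because `π_{n+1}(a)` leaves the graph of `D` invariant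
(`graphProj_mul_mul`): compressing to an invariant subspace and to its complement are both
multiplicative (`IsGradedRep.compress`). The extra projection `p_n ⊕ p_n` does no harm, since `p_n`
commutes with `θ_n` and with `D`, hence with `π_{n+1}`.

For injective `φ` the range is closed because `D` is closed and `θ_n` depends continuously on `π_n`.
Complete contractivity of the product is submultiplicativity of the C⋆-norm on rectangular matrices.
-/

noncomputable section

set_option linter.unusedSectionVars false

/-! ### Graphs and twisted commutators -/

section Operators

variable {B E : Type*} [NonUnitalCStarAlgebra B] [PartialOrder B] [StarOrderedRing B]
  [NormedAddCommGroup E] [NormedSpace ℂ E] [SMul B E] [CStarModule B E]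

namespace Adjointable

@[simp] theorem mul_val_apply (S T : Adjointable B E) (x : E) : (S * T).1 x = S.1 (T.1 x) := rfl
@[simp] theorem add_val_apply (S T : Adjointable B E) (x : E) : (S + T).1 x = S.1 x + T.1 x := rfl
@[simp] theorem sub_val_apply (S T : Adjointable B E) (x : E) : (S - T).1 x = S.1 x - T.1 x := rfl
@[simp] theorem neg_val_apply (S : Adjointable B E) (x : E) : (-S).1 x = -S.1 x := rfl
@[simp] theorem smul_val_apply (c : ℂ) (S : Adjointable B E) (x : E) :
    (c • S).1 x = c • S.1 x := rfl
@[simp] theorem one_val_apply (x : E) : (1 : Adjointable B E).1 x = x := rfl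
@[simp] theorem zero_val_apply (x : E) : (0 : Adjointable B E).1 x = 0 := rfl

theorem ext_apply {S T : Adjointable B E} (h : ∀ x, S.1 x = T.1 x) : S = T :=
  Subtype.ext (ContinuousLinearMap.ext h)

theorem ext_of_dense {s : Set E} (hs : Dense s) {S T : Adjointable B E}
    (h : ∀ x ∈ s, S.1 x = T.1 x) : S = T :=
  Subtype.ext (ContinuousLinearMap.coeFn_injective
    (Continuous.ext_on hs S.1.continuous T.1.continuous h))

theorem star_eq_of_inner {S T : Adjointable B E}
    (h : ∀ x y, inner B (T.1 x) y = inner B x (S.1 y)) : star T = S :=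
  ext_op fun x y => by rw [inner_star_right, h]

end Adjointable

variable {D : E →ₗ.[ℂ] E}

/-- In this form the relation says that the block matrix with rows `T, 0` and `S, T'` preserves the
graph of `D`. Domain conditions disappear, and closure under sums, products and limits follows from
the graph being a closed subspace. -/
theorem isTwistedCommutator_iff_graph {T T' S : Adjointable B E} :
    IsTwistedCommutator D T T' S ↔
      ∀ x y, (x, y) ∈ D.graph → (T.1 x, S.1 x + T'.1 y) ∈ D.graph := by
  constructor
  · intro h x y hxy
    obtain ⟨⟨x, hx⟩, rfl, rfl⟩ := (LinearPMap.mem_graph_iff D).1 hxy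
    obtain ⟨h1, h2⟩ := h ⟨x, hx⟩
    refine (LinearPMap.mem_graph_iff D).2 ⟨⟨_, h1⟩, rfl, ?_⟩
    rw [← h2]; simp
  · intro h x
    obtain ⟨z, h1, h2⟩ := (LinearPMap.mem_graph_iff D).1 (h _ _ (LinearPMap.mem_graph D x))
    have hz : T.1 x ∈ D.domain := by
      have := z.2
      rwa [h1] at this
    refine ⟨hz, ?_⟩
    have : z = ⟨T.1 x, hz⟩ := Subtype.ext h1
    rw [← this, h2]; simp

namespace IsTwistedCommutator

variable {T T' S T₁ T₁' S₁ T₂ T₂' S₂ : Adjointable B E}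

theorem add (h₁ : IsTwistedCommutator D T₁ T₁' S₁) (h₂ : IsTwistedCommutator D T₂ T₂' S₂) :
    IsTwistedCommutator D (T₁ + T₂) (T₁' + T₂') (S₁ + S₂) := by
  rw [isTwistedCommutator_iff_graph] at *
  intro x y hxy
  convert D.graph.add_mem (h₁ x y hxy) (h₂ x y hxy) using 1
  ext <;> simp
  abel

theorem smul (c : ℂ) (h : IsTwistedCommutator D T T' S) :
    IsTwistedCommutator D (c • T) (c • T') (c • S) := by
  rw [isTwistedCommutator_iff_graph] at *
  intro x y hxy
  convert D.graph.smul_mem c (h x y hxy) using 1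
  ext <;> simp

theorem neg (h : IsTwistedCommutator D T T' S) : IsTwistedCommutator D (-T) (-T') (-S) := by
  rw [isTwistedCommutator_iff_graph] at *
  intro x y hxy
  convert D.graph.neg_mem (h x y hxy) using 1
  ext <;> simp
  abel

theorem zero : IsTwistedCommutator D (0 : Adjointable B E) 0 0 := by
  rw [isTwistedCommutator_iff_graph]
  intro x y _
  simp

theorem one : IsTwistedCommutator D (1 : Adjointable B E) 1 0 := by
  rw [isTwistedCommutator_iff_graph]
  intro x y h
  simpa using h

theorem sum {κ : Type*} (s : Finset κ) {T T' S : κ → Adjointable B E}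
    (h : ∀ k ∈ s, IsTwistedCommutator D (T k) (T' k) (S k)) :
    IsTwistedCommutator D (∑ k ∈ s, T k) (∑ k ∈ s, T' k) (∑ k ∈ s, S k) := by
  classical
  induction s using Finset.induction_on with
  | empty => simpa using zero
  | insert a s ha ih =>
    simp only [Finset.sum_insert ha]
    exact (h _ (by simp)).add (ih fun k hk => h k (by simp [hk]))

theorem mul (h₁ : IsTwistedCommutator D T₁ T₁' S₁) (h₂ : IsTwistedCommutator D T₂ T₂' S₂) :
    IsTwistedCommutator D (T₁ * T₂) (T₁' * T₂') (S₁ * T₂ + T₁' * S₂) := by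
  rw [isTwistedCommutator_iff_graph] at *
  intro x y hxy
  convert h₁ _ _ (h₂ x y hxy) using 1
  ext <;> simp
  abel

theorem unique (hD : Dense (D.domain : Set E)) (h₁ : IsTwistedCommutator D T T' S₁)
    (h₂ : IsTwistedCommutator D T T' S₂) : S₁ = S₂ := by
  refine Adjointable.ext_of_dense hD fun x hx => ?_
  obtain ⟨_, e₁⟩ := h₁ ⟨x, hx⟩
  obtain ⟨_, e₂⟩ := h₂ ⟨x, hx⟩
  exact e₁.symm.trans e₂

theorem of_tendsto (hD : D.IsClosed) {κ : Type*} {l : Filter κ} [l.NeBot]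
    {t t' s : κ → Adjointable B E} (ht : Filter.Tendsto t l (nhds T))
    (ht' : Filter.Tendsto t' l (nhds T')) (hs : Filter.Tendsto s l (nhds S))
    (h : ∀ k, IsTwistedCommutator D (t k) (t' k) (s k)) : IsTwistedCommutator D T T' S := by
  rw [isTwistedCommutator_iff_graph]
  intro x y hxy
  have happ : ∀ {v : κ → Adjointable B E} {V : Adjointable B E}, Filter.Tendsto v l (nhds V) →
      ∀ x, Filter.Tendsto (fun k => (v k).1 x) l (nhds (V.1 x)) := fun hv x =>
    (((ContinuousLinearMap.apply ℂ E x).continuous.comp continuous_subtype_val).tendsto _).comp hv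
  have hD' : _root_.IsClosed (D.graph : Set (E × E)) := hD
  refine hD'.mem_of_tendsto ((happ ht x).prodMk_nhds ((happ hs x).add (happ ht' y)))
    (Filter.Eventually.of_forall fun k => isTwistedCommutator_iff_graph.1 (h k) x y hxy)

end IsTwistedCommutator

/-! ### Adjoints of commutators and the resolvent of a selfadjoint regular operator. -/

namespace IsSelfAdjointOp

theorem inner_graph (hs : IsSelfAdjointOp B D) {x x' y y' : E} (hx : (x, x') ∈ D.graph)
    (hy : (y, y') ∈ D.graph) : inner B x' y = inner B x y' := by
  obtain ⟨x, rfl, rfl⟩ := (LinearPMap.mem_graph_iff D).1 hx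
  obtain ⟨y, rfl, rfl⟩ := (LinearPMap.mem_graph_iff D).1 hy
  exact hs.1 x y

theorem mem_graph_of_isAdjointValue (hD : Dense (D.domain : Set E)) (hs : IsSelfAdjointOp B D)
    {y z : E} (h : IsAdjointValue B D y z) : (y, z) ∈ D.graph := by
  have hy : y ∈ D.domain := by
    have : y ∈ {y : E | ∃ z, IsAdjointValue B D y z} := ⟨z, h⟩
    rwa [hs.2] at this
  have hz : D ⟨y, hy⟩ = z := by
    refine Adjointable.ext_inner (B := B) fun w => ?_
    have hc : ∀ v : E, Continuous fun w : E => inner B w v := fun v =>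
      CStarModule.continuous_inner.comp (Continuous.prodMk continuous_id continuous_const)
    have := Continuous.ext_on hD (hc (D ⟨y, hy⟩)) (hc z) fun x hx => by
      rw [← h ⟨x, hx⟩]
      exact (hs.1 ⟨x, hx⟩ ⟨y, hy⟩).symm
    exact congrFun this w
  rw [← hz]
  exact LinearPMap.mem_graph D ⟨y, hy⟩

/-- The formal adjoint of `D T - T' D = S` is `T* D - D T'* = S*`. That `T'*` preserves the domain
comes from `Dom D* = Dom D`. -/
theorem isTwistedCommutator_star (hD : Dense (D.domain : Set E)) (hs : IsSelfAdjointOp B D)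
    {T T' S : Adjointable B E} (h : IsTwistedCommutator D T T' S) :
    IsTwistedCommutator D (star T') (star T) (-star S) := by
  rw [isTwistedCommutator_iff_graph] at *
  intro y y' hy
  refine hs.mem_graph_of_isAdjointValue hD fun x => ?_
  have h1 := hs.inner_graph (h _ _ (LinearPMap.mem_graph D x)) hy
  rw [CStarModule.inner_add_left] at h1
  simp only [CStarModule.inner_add_right, Adjointable.inner_star_right, Adjointable.neg_val_apply,
    CStarModule.inner_neg_right]
  rw [← h1]
  abel

/-- Here `y = D x` and `w = (1 + D²) x`, so `⟪x, w⟫ = ⟪x, x⟫ + ⟪y, y⟫` with both terms positive, and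
Cauchy–Schwarz bounds each. This yields uniqueness of `x`, `y` and boundedness of `(1 + D²)⁻¹` and
`D (1 + D²)⁻¹`. -/
theorem norm_sq_le_of_graph (hs : IsSelfAdjointOp B D) {x y w : E} (hx : (x, y) ∈ D.graph)
    (hy : (y, w - x) ∈ D.graph) : ‖x‖ ≤ ‖w‖ ∧ ‖y‖ ≤ ‖w‖ := by
  have h : inner B x w = inner B x x + inner B y y := by
    rw [hs.inner_graph hx hy, ← CStarModule.inner_add_right]
    congr 1
    abel
  have hxx : 0 ≤ inner B x x := CStarModule.inner_self_nonneg
  have hyy : 0 ≤ inner B y y := CStarModule.inner_self_nonneg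
  have h1 : ‖x‖ ^ 2 ≤ ‖x‖ * ‖w‖ := by
    rw [CStarModule.norm_sq_eq B]
    refine le_trans ?_ (CStarModule.norm_inner_le (A := B) E)
    rw [h]
    exact CStarAlgebra.norm_le_norm_of_nonneg_of_le hxx (le_add_of_nonneg_right hyy)
  have h2 : ‖y‖ ^ 2 ≤ ‖x‖ * ‖w‖ := by
    rw [CStarModule.norm_sq_eq B]
    refine le_trans ?_ (CStarModule.norm_inner_le (A := B) E)
    rw [h]
    exact CStarAlgebra.norm_le_norm_of_nonneg_of_le hyy (le_add_of_nonneg_left hxx)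
  have hx0 := norm_nonneg x
  have hw0 := norm_nonneg w
  have h3 : ‖x‖ ≤ ‖w‖ := by nlinarith
  refine ⟨h3, ?_⟩
  nlinarith [norm_nonneg y]

/-- Regularity gives `1 + D²` dense range; the bounds above make preimages of a convergent sequence
Cauchy, and closedness of the graph turns dense range into surjectivity. -/
theorem exists_graph_eq [CompleteSpace E] (hr : IsRegularOp B D) (hs : IsSelfAdjointOp B D)
    (w : E) : ∃ x y, (x, y) ∈ D.graph ∧ (y, w - x) ∈ D.graph := by
  obtain ⟨hD, hcl, -, hd⟩ := hr
  have hmem := hd w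
  rw [mem_closure_iff_seq_limit] at hmem
  obtain ⟨u, hu, hlim⟩ := hmem
  choose x z hz hxz using hu
  have hx : ∀ k, ((x k : E), D (x k)) ∈ D.graph := fun k => LinearPMap.mem_graph D _
  have hy : ∀ k, (D (x k), u k - x k) ∈ D.graph := fun k => by
    rw [← hxz k, add_sub_cancel_left]
    exact hs.mem_graph_of_isAdjointValue hD (hz k)
  have hb : ∀ j k, ‖(x j : E) - x k‖ ≤ ‖u j - u k‖ ∧ ‖D (x j) - D (x k)‖ ≤ ‖u j - u k‖ := by
    intro j k
    refine hs.norm_sq_le_of_graph (D.graph.sub_mem (hx j) (hx k)) ?_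
    convert D.graph.sub_mem (hy j) (hy k) using 1
    ext <;> simp
    abel
  have hcau := hlim.cauchySeq
  have hc : ∀ v : ℕ → E, (∀ j k, ‖v j - v k‖ ≤ ‖u j - u k‖) → CauchySeq v := by
    intro v hv
    rw [Metric.cauchySeq_iff] at hcau ⊢
    intro ε hε
    obtain ⟨N, hN⟩ := hcau ε hε
    refine ⟨N, fun m hm n hn => lt_of_le_of_lt ?_ (hN m hm n hn)⟩
    rw [dist_eq_norm, dist_eq_norm]
    exact hv m n
  obtain ⟨a, ha⟩ := cauchySeq_tendsto_of_complete (hc (fun k => x k) fun j k => (hb j k).1)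
  obtain ⟨b, hb⟩ := cauchySeq_tendsto_of_complete (hc (fun k => D (x k)) fun j k => (hb j k).2)
  have hcl' : _root_.IsClosed (D.graph : Set (E × E)) := hcl
  exact ⟨a, b, hcl'.mem_of_tendsto (ha.prodMk_nhds hb) (Filter.Eventually.of_forall hx),
    hcl'.mem_of_tendsto (hb.prodMk_nhds (hlim.sub ha)) (Filter.Eventually.of_forall hy)⟩

theorem eq_of_graph (hs : IsSelfAdjointOp B D) {w x y x' y' : E}
    (hx : (x, y) ∈ D.graph) (hy : (y, w - x) ∈ D.graph)
    (hx' : (x', y') ∈ D.graph) (hy' : (y', w - x') ∈ D.graph) : x = x' ∧ y = y' := by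
  have h := hs.norm_sq_le_of_graph (w := 0) (D.graph.sub_mem hx hx') (by
    convert D.graph.sub_mem hy hy' using 1
    ext <;> simp)
  simpa [sub_eq_zero] using h

/-- The operators `R = (1 + D²)⁻¹` and `b = D R`. -/
theorem exists_resolvent [CompleteSpace E] (hr : IsRegularOp B D) (hs : IsSelfAdjointOp B D) :
    ∃ R b : Adjointable B E, star R = R ∧ star b = b ∧
      ∀ e, (R.1 e, b.1 e) ∈ D.graph ∧ (b.1 e, e - R.1 e) ∈ D.graph := by
  choose r s hrs hsr using hs.exists_graph_eq hr
  have hadd : ∀ v w, r (v + w) = r v + r w ∧ s (v + w) = s v + s w := fun v w =>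
    hs.eq_of_graph (hrs _) (hsr _) (D.graph.add_mem (hrs v) (hrs w)) (by
      convert D.graph.add_mem (hsr v) (hsr w) using 1
      ext <;> simp
      abel)
  have hsmul : ∀ (c : ℂ) v, r (c • v) = c • r v ∧ s (c • v) = c • s v := fun c v =>
    hs.eq_of_graph (hrs _) (hsr _) (D.graph.smul_mem c (hrs v)) (by
      convert D.graph.smul_mem c (hsr v) using 1
      ext <;> simp [smul_sub])
  have hb := fun w => hs.norm_sq_le_of_graph (hrs w) (hsr w)
  let r' : E →L[ℂ] E := LinearMap.mkContinuous ⟨⟨r, fun v w => (hadd v w).1⟩,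
    fun c v => (hsmul c v).1⟩ 1 fun w => by simpa using (hb w).1
  let s' : E →L[ℂ] E := LinearMap.mkContinuous ⟨⟨s, fun v w => (hadd v w).2⟩,
    fun c v => (hsmul c v).2⟩ 1 fun w => by simpa using (hb w).2
  -- Both `⟪r x, y - r y⟫` and `⟪x - r x, r y⟫` equal `⟪s x, s y⟫`.
  have hr' : ∀ x y, inner B (r' x) y = inner B x (r' y) := fun x y => by
    change inner B (r x) y = inner B x (r y)
    have h1 := hs.inner_graph (hrs x) (hsr y)
    have h2 := hs.inner_graph (hsr x) (hrs y)
    rw [CStarModule.inner_sub_left] at h2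
    rw [CStarModule.inner_sub_right] at h1
    rw [h1, sub_left_inj] at h2
    exact h2.symm
  have hs' : ∀ x y, inner B (s' x) y = inner B x (s' y) := fun x y => by
    change inner B (s x) y = inner B x (s y)
    have h1 := hs.inner_graph (hsr x) (hsr y)
    have h2 := hs.inner_graph (hrs x) (hrs y)
    rw [CStarModule.inner_sub_left, CStarModule.inner_sub_right, h2, sub_left_inj] at h1
    exact h1.symm
  exact ⟨⟨r', r', hr'⟩, ⟨s', s', hs'⟩, Adjointable.star_eq_of_inner hr',
    Adjointable.star_eq_of_inner hs', fun e => ⟨hrs e, hsr e⟩⟩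

end IsSelfAdjointOp

/-- The graph is single-valued, so only one operator meets the condition behind the choice in
`leftComp`. -/
theorem leftComp_eq {T S : Adjointable B E} (h : ∀ e, (T.1 e, S.1 e) ∈ D.graph) :
    leftComp D T = S := by
  have key : ∀ S' : Adjointable B E, (∀ e : E, ∃ h : T.1 e ∈ D.domain, D ⟨T.1 e, h⟩ = S'.1 e) →
      S' = S := by
    intro S' hS'
    refine Adjointable.ext_apply fun e => ?_
    obtain ⟨h1, h2⟩ := hS' e
    rw [← h2]
    exact LinearPMap.mem_graph_snd_inj D (LinearPMap.mem_graph D ⟨_, h1⟩) (h e) rfl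
  refine key _ (Classical.epsilon_spec (p := fun S : Adjointable B E =>
    ∀ e : E, ∃ h : T.1 e ∈ D.domain, D ⟨T.1 e, h⟩ = S.1 e) ⟨S, fun e => ?_⟩)
  obtain ⟨z, h1, h2⟩ := (LinearPMap.mem_graph_iff D).1 (h e)
  have hz : T.1 e ∈ D.domain := by
    have := z.2
    rwa [h1] at this
  refine ⟨hz, ?_⟩
  have : z = ⟨T.1 e, hz⟩ := Subtype.ext h1
  rw [← this, h2]

theorem isResolvent_iff_graph {R : Adjointable B E} :
    IsResolvent B D R ↔ ∀ e, ∃ y, (R.1 e, y) ∈ D.graph ∧ (y, e - R.1 e) ∈ D.graph := by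
  constructor
  · intro h e
    obtain ⟨h1, h2, h3⟩ := h e
    refine ⟨_, LinearPMap.mem_graph D ⟨_, h1⟩, ?_⟩
    have : e - R.1 e = D ⟨D ⟨R.1 e, h1⟩, h2⟩ := by
      rw [sub_eq_iff_eq_add, add_comm]
      exact h3.symm
    rw [this]
    exact LinearPMap.mem_graph D ⟨_, h2⟩
  · intro h e
    obtain ⟨y, h1, h2⟩ := h e
    have hR : R.1 e ∈ D.domain := LinearPMap.mem_domain_of_mem_graph h1
    have hy : D ⟨R.1 e, hR⟩ = y :=
      LinearPMap.mem_graph_snd_inj D (LinearPMap.mem_graph D ⟨_, hR⟩) h1 rfl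
    subst hy
    have hy : D ⟨R.1 e, hR⟩ ∈ D.domain := LinearPMap.mem_domain_of_mem_graph h2
    refine ⟨hR, hy, ?_⟩
    rw [LinearPMap.mem_graph_snd_inj D (LinearPMap.mem_graph D ⟨_, hy⟩) h2 rfl]
    abel

theorem IsSelfAdjointOp.resolventOp_eq (hs : IsSelfAdjointOp B D) {R b : Adjointable B E}
    (h : ∀ e, (R.1 e, b.1 e) ∈ D.graph ∧ (b.1 e, e - R.1 e) ∈ D.graph) :
    resolventOp B D = R := by
  have hR : IsResolvent B D (resolventOp B D) :=
    Classical.epsilon_spec (p := IsResolvent B D) ⟨R, isResolvent_iff_graph.2 fun e => ⟨_, h e⟩⟩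
  refine Adjointable.ext_apply fun e => ?_
  obtain ⟨y, h1, h2⟩ := isResolvent_iff_graph.1 hR e
  exact (hs.eq_of_graph h1 h2 (h e).1 (h e).2).1

end Operators

/-! ### The resolvent and the grading of an unbounded bimodule. -/

namespace UnboundedBimodule

variable {A B E : Type*} [NonUnitalCStarAlgebra A] [NonUnitalCStarAlgebra B]
  [PartialOrder B] [StarOrderedRing B] [NormedAddCommGroup E] [NormedSpace ℂ E] [CompleteSpace E]
  [SMul B E] [CStarModule B E] (X : UnboundedBimodule A B E)

/-- The operator `D (1 + D²)⁻¹`. -/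
def dres : Adjointable B E := leftComp X.D X.res

theorem res_spec : star X.res = X.res ∧ star X.dres = X.dres ∧
    ∀ e, (X.res.1 e, X.dres.1 e) ∈ X.D.graph ∧ (X.dres.1 e, e - X.res.1 e) ∈ X.D.graph := by
  obtain ⟨R, b, hR, hb, h⟩ := X.selfAdjoint.exists_resolvent X.regular
  have h1 : X.res = R := X.selfAdjoint.resolventOp_eq h
  have h2 : X.dres = b := by
    rw [dres, h1]
    exact leftComp_eq fun e => (h e).1
  rw [h1, h2]
  exact ⟨hR, hb, h⟩

theorem star_res : star X.res = X.res := X.res_spec.1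
theorem star_dres : star X.dres = X.dres := X.res_spec.2.1
theorem res_graph (e : E) : (X.res.1 e, X.dres.1 e) ∈ X.D.graph := (X.res_spec.2.2 e).1
theorem dres_graph (e : E) : (X.dres.1 e, e - X.res.1 e) ∈ X.D.graph := (X.res_spec.2.2 e).2

theorem leftComp_dres : leftComp X.D (leftComp X.D X.res) = 1 - X.res :=
  leftComp_eq fun e => by simpa using! X.dres_graph e

/-- Both pairs `(R y, D R y)` and `(D R x, x - R x)` solve `(1 + D²) u = y`, `v = D u`; uniqueness
identifies them. All commutation relations among `D`, `R` and `D R` come from this. -/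
theorem res_dres_of_graph {x y : E} (h : (x, y) ∈ X.D.graph) :
    X.res.1 y = X.dres.1 x ∧ X.dres.1 y = x - X.res.1 x := by
  have h1 := X.dres_graph x
  refine X.selfAdjoint.eq_of_graph (X.res_graph y) (X.dres_graph y) h1 ?_
  exact X.D.graph.sub_mem h (X.res_graph x)

theorem isTwistedCommutator_res : IsTwistedCommutator X.D X.res X.res 0 :=
  isTwistedCommutator_iff_graph.2 fun x y h => by
    have := X.res_graph x
    rw [(X.res_dres_of_graph h).1]
    simpa using this

theorem isTwistedCommutator_dres : IsTwistedCommutator X.D X.dres X.dres 0 :=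
  isTwistedCommutator_iff_graph.2 fun x y h => by
    have := X.dres_graph x
    rw [(X.res_dres_of_graph h).2]
    simpa using this

theorem res_mul_dres : X.res * X.dres = X.dres * X.res :=
  Adjointable.ext_apply fun e => (X.res_dres_of_graph (X.res_graph e)).1

theorem dres_mul_dres : X.dres * X.dres = X.res - X.res * X.res :=
  Adjointable.ext_apply fun e => (X.res_dres_of_graph (X.res_graph e)).2

variable {X} {T T' S : Adjointable B E}

/-- The columns `(R e, D R e)` and `(D R e, e - R e)` of the graph projection lie in the graph, and
the block matrix of `T, S, T'` keeps them there. These are the four block entries of the invariance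
used in `graphProj_mul_mul`. -/
theorem res_mul_commutator (h : IsTwistedCommutator X.D T T' S) :
    X.res * (S * X.res + T' * X.dres) = X.dres * (T * X.res) ∧
    X.dres * (S * X.res + T' * X.dres) = (1 - X.res) * (T * X.res) ∧
    X.res * (S * X.dres + T' * (1 - X.res)) = X.dres * (T * X.dres) ∧
    X.dres * (S * X.dres + T' * (1 - X.res)) = (1 - X.res) * (T * X.dres) := by
  rw [isTwistedCommutator_iff_graph] at h
  have h1 := fun e => X.res_dres_of_graph (h _ _ (X.res_graph e))
  have h2 := fun e => X.res_dres_of_graph (h _ _ (X.dres_graph e))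
  exact ⟨Adjointable.ext_apply fun e => (h1 e).1, Adjointable.ext_apply fun e => (h1 e).2,
    Adjointable.ext_apply fun e => (h2 e).1, Adjointable.ext_apply fun e => (h2 e).2⟩

variable (X)

theorem norm_gradE (e : E) : ‖X.gradE e‖ = ‖e‖ := by
  rw [CStarModule.norm_eq_sqrt_norm_inner_self (A := B) (X.gradE e), X.inner_gradE,
    StarAlgEquiv.norm_map, ← CStarModule.norm_eq_sqrt_norm_inner_self (A := B) e]

theorem inner_gradE_left (e f : E) :
    inner B (X.gradE e) f = X.gradB (inner B e (X.gradE f)) := by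
  rw [← X.inner_gradE, X.gradE_gradE]

/-- The grading operator, as a bounded operator. -/
def gradECLM : E →L[ℂ] E := X.gradE.mkContinuous 1 fun e => by simp [X.norm_gradE]

@[simp] theorem gradECLM_apply (e : E) : X.gradECLM e = X.gradE e := rfl

/-- Moving the grading operator across the inner product costs a twist by `gradB`; in a conjugation
it moves twice and the twists cancel. -/
theorem gradE_conj_adjoint (T : Adjointable B E) (x y : E) :
    inner B (X.gradE (T.1 (X.gradE x))) y = inner B x (X.gradE ((star T).1 (X.gradE y))) := by
  rw [inner_gradE_left, ← Adjointable.inner_star_right, ← X.inner_gradE, X.gradE_gradE]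

/-- The grading automorphism of `End*_B(E)`. -/
def gradEnd : Adjointable B E →⋆ₐ[ℂ] Adjointable B E where
  toFun T := ⟨X.gradECLM * T.1 * X.gradECLM, X.gradECLM * (star T).1 * X.gradECLM,
    X.gradE_conj_adjoint T⟩
  map_one' := Adjointable.ext_apply fun e => X.gradE_gradE e
  map_mul' S T := Adjointable.ext_apply fun e => by simp [X.gradE_gradE]
  map_zero' := Adjointable.ext_apply fun e => by simp
  map_add' S T := Adjointable.ext_apply fun e => by simp
  commutes' c := Adjointable.ext_apply fun e => by
    simp [Algebra.algebraMap_eq_smul_one, X.gradE_gradE]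
  map_star' T := (Adjointable.star_eq_of_inner fun x y => X.gradE_conj_adjoint T x y).symm

@[simp] theorem gradEnd_apply (T : Adjointable B E) (e : E) :
    (X.gradEnd T).1 e = X.gradE (T.1 (X.gradE e)) := rfl

theorem gradEnd_gradEnd (T : Adjointable B E) : X.gradEnd (X.gradEnd T) = T :=
  Adjointable.ext_apply fun e => by simp [X.gradE_gradE]

theorem φ_gradA_eq (a : A) : X.φ (X.gradA a) = X.gradEnd (X.φ a) :=
  Adjointable.ext_apply fun e => X.φ_gradA a e

theorem gradE_graph {x y : E} (h : (x, y) ∈ X.D.graph) :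
    (X.gradE x, -X.gradE y) ∈ X.D.graph := by
  obtain ⟨x, rfl, rfl⟩ := (LinearPMap.mem_graph_iff X.D).1 h
  obtain ⟨h1, h2⟩ := X.odd x
  rw [← h2]
  exact LinearPMap.mem_graph X.D ⟨_, h1⟩

theorem isTwistedCommutator_gradEnd (h : IsTwistedCommutator X.D T T' S) :
    IsTwistedCommutator X.D (X.gradEnd T) (X.gradEnd T') (-X.gradEnd S) := by
  rw [isTwistedCommutator_iff_graph] at *
  intro x y hxy
  convert X.gradE_graph (h _ _ (X.gradE_graph hxy)) using 1
  ext <;> simp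
  abel

/-- Oddness of `D`: conjugation by the grading takes `D` to `-D`, and uniqueness of the solution of
`(1 + D²) x = e` transfers this to `R` and `D R`. -/
theorem gradEnd_res_dres : X.gradEnd X.res = X.res ∧ X.gradEnd X.dres = -X.dres := by
  have h : ∀ e, (X.gradEnd X.res).1 e = X.res.1 e ∧ (X.gradEnd X.dres).1 e = (-X.dres).1 e := by
    intro e
    have h1 := X.gradE_graph (X.res_graph (X.gradE e))
    have h2 := X.D.graph.neg_mem (X.gradE_graph (X.dres_graph (X.gradE e)))
    have := X.selfAdjoint.eq_of_graph (w := e) h1 (by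
      convert h2 using 1
      ext <;> simp [X.gradE_gradE]) (X.res_graph e) (X.dres_graph e)
    exact ⟨this.1, by simp [← this.2]⟩
  exact ⟨Adjointable.ext_apply fun e => (h e).1, Adjointable.ext_apply fun e => (h e).2⟩

end UnboundedBimodule

/-! ### Block automorphisms of matrix algebras -/

section BlockHom

variable {ι R : Type*} [Fintype ι] [DecidableEq ι] [Ring R] [StarRing R] [Algebra ℂ R]
  [StarModule ℂ R]

open Matrix

/-- The homomorphism `[[α, β], [κ, δ]] ↦ [[Φ α, ε Φ β], [ε Φ κ, Φ δ]]`. -/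
def blockHom (Φ : Matrix ι ι R →⋆ₐ[ℂ] Matrix ι ι R) (ε : ℤˣ) :
    Matrix (ι ⊕ ι) (ι ⊕ ι) R →⋆ₐ[ℂ] Matrix (ι ⊕ ι) (ι ⊕ ι) R where
  toFun M := fromBlocks (Φ M.toBlocks₁₁) (ε • Φ M.toBlocks₁₂) (ε • Φ M.toBlocks₂₁)
    (Φ M.toBlocks₂₂)
  map_one' := by
    rw [← fromBlocks_one]
    simp [-fromBlocks_one]
  map_mul' M N := by
    rw [← fromBlocks_toBlocks M, ← fromBlocks_toBlocks N]
    simp [fromBlocks_multiply, smul_smul]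
  map_zero' := by
    rw [← fromBlocks_zero]
    simp [-fromBlocks_zero]
  map_add' M N := by
    rw [← fromBlocks_toBlocks M, ← fromBlocks_toBlocks N]
    simp [fromBlocks_add]
  commutes' c := by
    rw [Algebra.algebraMap_eq_smul_one, ← fromBlocks_one, fromBlocks_smul]
    simp [-fromBlocks_one]
  map_star' M := by
    rw [← fromBlocks_toBlocks M]
    simp only [star_eq_conjTranspose, fromBlocks_conjTranspose, toBlocks_fromBlocks₁₁,
      toBlocks_fromBlocks₁₂, toBlocks_fromBlocks₂₁, toBlocks_fromBlocks₂₂]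
    simp only [← star_eq_conjTranspose, map_star, Units.smul_def, star_smul, star_trivial]

@[simp] theorem blockHom_fromBlocks (Φ : Matrix ι ι R →⋆ₐ[ℂ] Matrix ι ι R) (ε : ℤˣ)
    (α β κ δ : Matrix ι ι R) : blockHom Φ ε (fromBlocks α β κ δ) =
      fromBlocks (Φ α) (ε • Φ β) (ε • Φ κ) (Φ δ) := rfl

/-- The homomorphism `[[α, β], [κ, δ]] ↦ [[Φ δ, ε Φ κ], [ε Φ β, Φ α]]`. -/
def blockSwapHom (Φ : Matrix ι ι R →⋆ₐ[ℂ] Matrix ι ι R) (ε : ℤˣ) :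
    Matrix (ι ⊕ ι) (ι ⊕ ι) R →⋆ₐ[ℂ] Matrix (ι ⊕ ι) (ι ⊕ ι) R where
  toFun M := fromBlocks (Φ M.toBlocks₂₂) (ε • Φ M.toBlocks₂₁) (ε • Φ M.toBlocks₁₂)
    (Φ M.toBlocks₁₁)
  map_one' := by
    rw [← fromBlocks_one]
    simp [-fromBlocks_one]
  -- After `Φ` on blocks this is conjugation by the flip and by `diag(1, ε)`: `ε * ε = 1`, and the
  -- flip reverses the order of the two terms in each block.
  map_mul' M N := by
    rw [← fromBlocks_toBlocks M, ← fromBlocks_toBlocks N]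
    simp [fromBlocks_multiply, smul_smul, add_comm]
  map_zero' := by
    rw [← fromBlocks_zero]
    simp [-fromBlocks_zero]
  map_add' M N := by
    rw [← fromBlocks_toBlocks M, ← fromBlocks_toBlocks N]
    simp [fromBlocks_add]
  commutes' c := by
    rw [Algebra.algebraMap_eq_smul_one, ← fromBlocks_one, fromBlocks_smul]
    simp [-fromBlocks_one]
  map_star' M := by
    rw [← fromBlocks_toBlocks M]
    simp only [star_eq_conjTranspose, fromBlocks_conjTranspose, toBlocks_fromBlocks₁₁,
      toBlocks_fromBlocks₁₂, toBlocks_fromBlocks₂₁, toBlocks_fromBlocks₂₂]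
    simp only [← star_eq_conjTranspose, map_star, Units.smul_def, star_smul, star_trivial]

@[simp] theorem blockSwapHom_fromBlocks (Φ : Matrix ι ι R →⋆ₐ[ℂ] Matrix ι ι R) (ε : ℤˣ)
    (α β κ δ : Matrix ι ι R) : blockSwapHom Φ ε (fromBlocks α β κ δ) =
      fromBlocks (Φ δ) (ε • Φ κ) (ε • Φ β) (Φ α) := rfl

theorem blockHom_injective {Φ : Matrix ι ι R →⋆ₐ[ℂ] Matrix ι ι R} (h : Function.Injective Φ)
    (ε : ℤˣ) : Function.Injective (blockHom Φ ε) := by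
  intro M N hMN
  rw [← fromBlocks_toBlocks M, ← fromBlocks_toBlocks N] at hMN ⊢
  simpa [fromBlocks_inj, h.eq_iff] using hMN

theorem blockSwapHom_injective {Φ : Matrix ι ι R →⋆ₐ[ℂ] Matrix ι ι R} (h : Function.Injective Φ)
    (ε : ℤˣ) : Function.Injective (blockSwapHom Φ ε) := by
  intro M N hMN
  rw [← fromBlocks_toBlocks M, ← fromBlocks_toBlocks N] at hMN ⊢
  simp only [blockSwapHom_fromBlocks, fromBlocks_inj, h.eq_iff, smul_left_cancel_iff] at hMN ⊢
  tauto

theorem blockHom_continuous [TopologicalSpace R] [IsTopologicalRing R]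
    {Φ : Matrix ι ι R →⋆ₐ[ℂ] Matrix ι ι R} (h : Continuous Φ) (ε : ℤˣ) :
    Continuous (blockHom Φ ε) := by
  have hb : ∀ f g : ι → ι ⊕ ι,
      Continuous fun M : Matrix (ι ⊕ ι) (ι ⊕ ι) R => Φ (M.submatrix f g) := fun f g =>
    h.comp (continuous_id.matrix_submatrix f g)
  have hs : ∀ f g : ι → ι ⊕ ι,
      Continuous fun M : Matrix (ι ⊕ ι) (ι ⊕ ι) R => ε • Φ (M.submatrix f g) := fun f g => by
    obtain rfl | rfl := Int.units_eq_one_or ε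
    · simpa using hb f g
    · simpa only [Units.neg_smul, one_smul] using! (hb f g).neg
  exact (hb Sum.inl Sum.inl).matrix_fromBlocks (hs Sum.inl Sum.inr) (hs Sum.inr Sum.inl)
    (hb Sum.inr Sum.inr)

end BlockHom

/-! ### Commutators with matrices of operators -/

section MatrixCommutator

variable {B E : Type*} [NonUnitalCStarAlgebra B] [PartialOrder B] [StarOrderedRing B]
  [NormedAddCommGroup E] [NormedSpace ℂ E] [SMul B E] [CStarModule B E] {D : E →ₗ.[ℂ] E}
  {ι : Type}

/-- `D T - T' D` is the restriction of `S`, with `D` acting diagonally. -/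
def IsMatrixCommutator (D : E →ₗ.[ℂ] E) (T T' S : Matrix ι ι (Adjointable B E)) : Prop :=
  ∀ i j, IsTwistedCommutator D (T i j) (T' i j) (S i j)

theorem HasTwistedCommutator.isMatrixCommutator {T T' : Matrix ι ι (Adjointable B E)}
    (h : HasTwistedCommutator D T T') : IsMatrixCommutator D T T' (twistedCommutator D T T') :=
  Classical.epsilon_spec (p := fun S => IsMatrixCommutator D T T' S) h

namespace IsMatrixCommutator

variable {T T' S T₁ T₁' S₁ T₂ T₂' S₂ : Matrix ι ι (Adjointable B E)}

theorem has (h : IsMatrixCommutator D T T' S) : HasTwistedCommutator D T T' := ⟨S, h⟩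

theorem unique (hD : Dense (D.domain : Set E)) (h₁ : IsMatrixCommutator D T T' S₁)
    (h₂ : IsMatrixCommutator D T T' S₂) : S₁ = S₂ :=
  Matrix.ext fun i j => (h₁ i j).unique hD (h₂ i j)

theorem twistedCommutator_eq (hD : Dense (D.domain : Set E)) (h : IsMatrixCommutator D T T' S) :
    twistedCommutator D T T' = S :=
  h.has.isMatrixCommutator.unique hD h

theorem add (h₁ : IsMatrixCommutator D T₁ T₁' S₁) (h₂ : IsMatrixCommutator D T₂ T₂' S₂) :
    IsMatrixCommutator D (T₁ + T₂) (T₁' + T₂') (S₁ + S₂) := fun i j => (h₁ i j).add (h₂ i j)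

theorem smul (c : ℂ) (h : IsMatrixCommutator D T T' S) :
    IsMatrixCommutator D (c • T) (c • T') (c • S) := fun i j => (h i j).smul c

theorem neg (h : IsMatrixCommutator D T T' S) : IsMatrixCommutator D (-T) (-T') (-S) :=
  fun i j => (h i j).neg

theorem units_smul (ε : ℤˣ) (h : IsMatrixCommutator D T T' S) :
    IsMatrixCommutator D (ε • T) (ε • T') (ε • S) := by
  obtain rfl | rfl := Int.units_eq_one_or ε
  · simpa using h
  · simpa using h.neg

theorem zero : IsMatrixCommutator D (0 : Matrix ι ι (Adjointable B E)) 0 0 :=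
  fun _ _ => IsTwistedCommutator.zero

theorem diagonal [DecidableEq ι] {a : Adjointable B E} (h : IsTwistedCommutator D a a 0) :
    IsMatrixCommutator D (Matrix.diagonal fun _ : ι => a) (Matrix.diagonal fun _ => a) 0 := by
  intro i j
  obtain rfl | hij := eq_or_ne i j
  · simpa using h
  · simpa [hij] using IsTwistedCommutator.zero

theorem one [DecidableEq ι] :
    IsMatrixCommutator D (1 : Matrix ι ι (Adjointable B E)) 1 0 :=
  diagonal IsTwistedCommutator.one

theorem mul [Fintype ι] (h₁ : IsMatrixCommutator D T₁ T₁' S₁)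
    (h₂ : IsMatrixCommutator D T₂ T₂' S₂) :
    IsMatrixCommutator D (T₁ * T₂) (T₁' * T₂') (S₁ * T₂ + T₁' * S₂) := fun i j => by
  simp only [Matrix.mul_apply, Matrix.add_apply, ← Finset.sum_add_distrib]
  exact IsTwistedCommutator.sum _ fun k _ => (h₁ i k).mul (h₂ k j)

theorem star (hD : Dense (D.domain : Set E)) (hs : IsSelfAdjointOp B D)
    (h : IsMatrixCommutator D T T' S) :
    IsMatrixCommutator D (star T') (star T) (-star S) := fun i j =>
  hs.isTwistedCommutator_star hD (h j i)

theorem of_tendsto (hD : D.IsClosed) {κ : Type*} {l : Filter κ} [l.NeBot]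
    {t t' s : κ → Matrix ι ι (Adjointable B E)} (ht : Filter.Tendsto t l (nhds T))
    (ht' : Filter.Tendsto t' l (nhds T')) (hs : Filter.Tendsto s l (nhds S))
    (h : ∀ k, IsMatrixCommutator D (t k) (t' k) (s k)) : IsMatrixCommutator D T T' S :=
  fun i j => IsTwistedCommutator.of_tendsto hD ((ht.apply_nhds i).apply_nhds j)
    ((ht'.apply_nhds i).apply_nhds j) ((hs.apply_nhds i).apply_nhds j) fun k => h k i j

theorem fromBlocks {a a' u b b' v c c' w d d' z : Matrix ι ι (Adjointable B E)}
    (ha : IsMatrixCommutator D a a' u) (hb : IsMatrixCommutator D b b' v)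
    (hc : IsMatrixCommutator D c c' w) (hd : IsMatrixCommutator D d d' z) :
    IsMatrixCommutator D (Matrix.fromBlocks a b c d) (Matrix.fromBlocks a' b' c' d')
      (Matrix.fromBlocks u v w z) := by
  rintro (i | i) (j | j)
  exacts [ha i j, hb i j, hc i j, hd i j]

theorem blocks {a a' u b b' v c c' w d d' z : Matrix ι ι (Adjointable B E)}
    (h : IsMatrixCommutator D (Matrix.fromBlocks a b c d) (Matrix.fromBlocks a' b' c' d')
      (Matrix.fromBlocks u v w z)) :
    IsMatrixCommutator D a a' u ∧ IsMatrixCommutator D b b' v ∧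
      IsMatrixCommutator D c c' w ∧ IsMatrixCommutator D d d' z :=
  ⟨fun i j => h (.inl i) (.inl j), fun i j => h (.inl i) (.inr j),
    fun i j => h (.inr i) (.inl j), fun i j => h (.inr i) (.inr j)⟩

/-- As `w` commutes with `D`, the commutators of `w T` and `T w` are `w S` and `S w`; the products
agree, so the commutators do. -/
theorem commute [Fintype ι] (hD : Dense (D.domain : Set E)) (h : IsMatrixCommutator D T T' S)
    {w : Matrix ι ι (Adjointable B E)} (hw : IsMatrixCommutator D w w 0) (h₁ : Commute w T)
    (h₂ : Commute w T') : Commute w S := by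
  have e₁ := hw.mul h
  have e₂ := h.mul hw
  rw [h₁.eq, h₂.eq] at e₁
  rw [commute_iff_eq]
  simpa using e₁.unique hD e₂

end IsMatrixCommutator

end MatrixCommutator

/-! ### Symmetries of `D` and the projection onto its graph. -/

namespace UnboundedBimodule

variable {A B E : Type*} [NonUnitalCStarAlgebra A] [NonUnitalCStarAlgebra B]
  [PartialOrder B] [StarOrderedRing B] [NormedAddCommGroup E] [NormedSpace ℂ E] [CompleteSpace E]
  [SMul B E] [CStarModule B E] (X : UnboundedBimodule A B E)
  {ι : Type} [Fintype ι] [DecidableEq ι]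

open Matrix

/-- The endomorphism `Φ` of `End*_B(E^ι)` sends `D` to `ε D`. -/
structure IsSymmetry (Φ : Matrix ι ι (Adjointable B E) →⋆ₐ[ℂ] Matrix ι ι (Adjointable B E))
    (ε : ℤˣ) : Prop where
  map_res : Φ (diagonal fun _ => X.res) = diagonal fun _ => X.res
  map_dres : Φ (diagonal fun _ => X.dres) = ε • diagonal fun _ => X.dres
  map_commutator : ∀ {T T' S}, IsMatrixCommutator X.D T T' S →
    IsMatrixCommutator X.D (Φ T) (Φ T') (ε • Φ S)

namespace IsSymmetry

variable {X} {Φ Ψ : Matrix ι ι (Adjointable B E) →⋆ₐ[ℂ] Matrix ι ι (Adjointable B E)} {ε ε' : ℤˣ}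

theorem id : X.IsSymmetry (StarAlgHom.id ℂ (Matrix ι ι (Adjointable B E))) 1 :=
  ⟨rfl, by simp, fun h => by simpa using h⟩

theorem comp (hΦ : X.IsSymmetry Φ ε) (hΨ : X.IsSymmetry Ψ ε') :
    X.IsSymmetry (Φ.comp Ψ) (ε * ε') where
  map_res := by simp [hΦ.map_res, hΨ.map_res]
  map_dres := by
    simp only [StarAlgHom.comp_apply, hΨ.map_dres, Units.smul_def, map_zsmul, hΦ.map_dres, smul_smul]
    push_cast
    rw [mul_comm]
  map_commutator h := by
    have := hΦ.map_commutator (hΨ.map_commutator h)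
    simpa only [StarAlgHom.comp_apply, Units.smul_def, map_zsmul, smul_smul, Units.val_mul]
      using this

/-- The off-diagonal sign `η` is free: `D` acts diagonally, and a commutator relation may be
multiplied by `η`. -/
theorem blockHom (h : X.IsSymmetry Φ ε) (η : ℤˣ) : X.IsSymmetry (blockHom Φ η) ε where
  map_res := by
    rw [← Sum.elim_lam_const_lam_const, ← fromBlocks_diagonal]
    simp [h.map_res, -fromBlocks_diagonal]
  map_dres := by
    rw [← Sum.elim_lam_const_lam_const, ← fromBlocks_diagonal]
    simp only [blockHom_fromBlocks, h.map_dres, map_zero, smul_zero, fromBlocks_smul]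
  map_commutator {T T' S} hT := by
    rw [← fromBlocks_toBlocks T, ← fromBlocks_toBlocks T', ← fromBlocks_toBlocks S] at hT ⊢
    obtain ⟨h1, h2, h3, h4⟩ := hT.blocks
    simp only [blockHom_fromBlocks, fromBlocks_smul, smul_comm ε η]
    exact .fromBlocks (h.map_commutator h1) ((h.map_commutator h2).units_smul η)
      ((h.map_commutator h3).units_smul η) (h.map_commutator h4)

theorem blockSwapHom (h : X.IsSymmetry Φ ε) (η : ℤˣ) : X.IsSymmetry (blockSwapHom Φ η) ε where
  map_res := by
    rw [← Sum.elim_lam_const_lam_const, ← fromBlocks_diagonal]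
    simp [h.map_res, -fromBlocks_diagonal]
  map_dres := by
    rw [← Sum.elim_lam_const_lam_const, ← fromBlocks_diagonal]
    simp only [blockSwapHom_fromBlocks, h.map_dres, map_zero, smul_zero, fromBlocks_smul]
  map_commutator {T T' S} hT := by
    rw [← fromBlocks_toBlocks T, ← fromBlocks_toBlocks T', ← fromBlocks_toBlocks S] at hT ⊢
    obtain ⟨h1, h2, h3, h4⟩ := hT.blocks
    simp only [blockSwapHom_fromBlocks, fromBlocks_smul, smul_comm ε η]
    exact .fromBlocks (h.map_commutator h4) ((h.map_commutator h3).units_smul η)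
      ((h.map_commutator h2).units_smul η) (h.map_commutator h1)

end IsSymmetry

variable (ι) in
/-- The projection onto the graph of `D`, acting diagonally on `E^ι`. -/
def graphProj : Matrix (ι ⊕ ι) (ι ⊕ ι) (Adjointable B E) :=
  fromBlocks (diagonal fun _ => X.res) (diagonal fun _ => X.dres)
    (diagonal fun _ => X.dres) (1 - diagonal fun _ => X.res)

theorem diagonal_res_dres (ι : Type) [Fintype ι] [DecidableEq ι] :
    (diagonal fun _ : ι => X.res) * (diagonal fun _ => X.dres) =
      (diagonal fun _ => X.dres) * (diagonal fun _ => X.res) ∧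
    (diagonal fun _ : ι => X.dres) * (diagonal fun _ => X.dres) =
      (diagonal fun _ => X.res) - (diagonal fun _ => X.res) * (diagonal fun _ => X.res) := by
  constructor
  · simp [X.res_mul_dres]
  · simp [X.dres_mul_dres]

theorem graphProj_mul_self : X.graphProj ι * X.graphProj ι = X.graphProj ι := by
  obtain ⟨h1, h2⟩ := X.diagonal_res_dres ι
  rw [graphProj, fromBlocks_multiply]
  congr 1
  · rw [h2]; abel
  · rw [mul_sub, h1, mul_one]; abel
  · rw [sub_mul, h1, one_mul]; abel
  · rw [h2]; noncomm_ring

theorem star_graphProj : star (X.graphProj ι) = X.graphProj ι := by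
  simp [graphProj, star_eq_conjTranspose, fromBlocks_conjTranspose, diagonal_conjTranspose,
    Pi.star_def, X.star_res, X.star_dres]

theorem graphProj_isMatrixCommutator :
    IsMatrixCommutator X.D (X.graphProj ι) (X.graphProj ι) 0 := by
  rw [← fromBlocks_zero]
  have h1 := IsMatrixCommutator.diagonal (ι := ι) X.isTwistedCommutator_res
  have h2 := IsMatrixCommutator.diagonal (ι := ι) X.isTwistedCommutator_dres
  refine .fromBlocks h1 h2 h2 ?_
  simpa [sub_eq_add_neg] using IsMatrixCommutator.one.add h1.neg

theorem commute_graphProj_diagonal {a : Adjointable B E} (h₁ : Commute a X.res)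
    (h₂ : Commute a X.dres) : Commute (X.graphProj ι) (diagonal fun _ => a) := by
  rw [← Sum.elim_lam_const_lam_const, ← fromBlocks_diagonal, graphProj, commute_iff_eq]
  simp [fromBlocks_multiply, sub_mul, mul_sub, h₁.eq, h₂.eq, -fromBlocks_diagonal]

theorem commute_graphProj_of_commute {w : Matrix ι ι (Adjointable B E)}
    (h₁ : Commute w (diagonal fun _ => X.res)) (h₂ : Commute w (diagonal fun _ => X.dres)) :
    Commute (fromBlocks w 0 0 w) (X.graphProj ι) := by
  rw [graphProj, commute_iff_eq]
  simp [fromBlocks_multiply, sub_mul, mul_sub, h₁.eq, h₂.eq, -fromBlocks_diagonal]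

/-- The entries of one projection are polynomials in `R` and `D R`, which commute with each other
and, placed diagonally, form the blocks of the other projection. -/
theorem commute_graphProj_ext :
    Commute (fromBlocks (X.graphProj ι) 0 0 (X.graphProj ι)) (X.graphProj (ι ⊕ ι)) :=
  X.commute_graphProj_of_commute
    (X.commute_graphProj_diagonal (Commute.refl _) X.res_mul_dres)
    (X.commute_graphProj_diagonal X.res_mul_dres.symm (Commute.refl _))

variable {X} in
theorem graphProj_mul_mul {T T' S : Matrix ι ι (Adjointable B E)}
    (h : IsMatrixCommutator X.D T T' S) :
    X.graphProj ι * fromBlocks T 0 S T' * X.graphProj ι =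
      fromBlocks T 0 S T' * X.graphProj ι := by
  set r : Matrix ι ι (Adjointable B E) := diagonal fun _ => X.res with hr
  set d : Matrix ι ι (Adjointable B E) := diagonal fun _ => X.dres with hd
  have hr' : 1 - r = diagonal fun _ => 1 - X.res := by
    rw [hr, ← diagonal_one, diagonal_sub]
  have h1 : r * (S * r + T' * d) = d * (T * r) := by
    ext1 i j
    simpa [hr, hd] using (res_mul_commutator (h i j)).1
  have h2 : d * (S * r + T' * d) = (1 - r) * (T * r) := by
    rw [hr']
    ext1 i j
    simpa [hr, hd] using (res_mul_commutator (h i j)).2.1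
  have h3 : r * (S * d + T' * (1 - r)) = d * (T * d) := by
    rw [hr']
    ext1 i j
    simpa [hr, hd] using (res_mul_commutator (h i j)).2.2.1
  have h4 : d * (S * d + T' * (1 - r)) = (1 - r) * (T * d) := by
    rw [hr']
    ext1 i j
    simpa [hr, hd] using (res_mul_commutator (h i j)).2.2.2
  rw [mul_assoc, graphProj, ← hr, ← hd, fromBlocks_multiply, fromBlocks_multiply]
  simp only [zero_mul, add_zero]
  congr 1
  · rw [h2]; noncomm_ring
  · rw [h4]; noncomm_ring
  · rw [sub_mul, h1]; noncomm_ring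
  · rw [sub_mul, h3]; noncomm_ring

theorem IsSymmetry.blockHom_graphProj {X : UnboundedBimodule A B E}
    {Φ : Matrix ι ι (Adjointable B E) →⋆ₐ[ℂ] Matrix ι ι (Adjointable B E)} {ε : ℤˣ}
    (h : X.IsSymmetry Φ ε) : _root_.blockHom Φ ε (X.graphProj ι) = X.graphProj ι := by
  simp [graphProj, h.map_res, h.map_dres, smul_smul]

/-- The flip exchanges `R` and `1 - R` on the diagonal. The opposite signs `-ε` of `Φ` and `ε` of
the blocks turn `D R` into `-D R`, as the complementary projection requires. -/
theorem IsSymmetry.blockSwapHom_graphProj {X : UnboundedBimodule A B E}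
    {Φ : Matrix ι ι (Adjointable B E) →⋆ₐ[ℂ] Matrix ι ι (Adjointable B E)} {ε : ℤˣ}
    (h : X.IsSymmetry Φ (-ε)) : _root_.blockSwapHom Φ ε (X.graphProj ι) = 1 - X.graphProj ι := by
  rw [← fromBlocks_one]
  simp only [graphProj, blockSwapHom_fromBlocks, map_sub, map_one, h.map_res, h.map_dres, smul_smul,
    smul_neg, Int.units_mul_self, Units.neg_smul, one_smul]
  simp only [sub_eq_add_neg, fromBlocks_neg, fromBlocks_add, zero_add, neg_add, neg_neg,
    add_neg_cancel_left]

end UnboundedBimodule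

/-! ### The representations of the Sobolev subalgebras -/

namespace UnboundedBimodule

variable {A B E : Type*} [NonUnitalCStarAlgebra A] [NonUnitalCStarAlgebra B]
  [PartialOrder B] [StarOrderedRing B] [NormedAddCommGroup E] [NormedSpace ℂ E] [CompleteSpace E]
  [SMul B E] [CStarModule B E] (X : UnboundedBimodule A B E)

open Matrix

theorem gradA_star (a : A) : X.gradA (star a) = star (X.gradA a) := map_star X.gradA a

/-- The sum is block diagonal for `p` and `1 - p`, whatever `q`, `q'` and `M` are. Thus `p_n`
commutes with `θ_n`. -/
theorem commute_compress {R : Type*} [Ring R] {p : R} (hp : p * p = p) (q q' M : R) :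
    Commute p (p * q * M * q * p + (1 - p) * q' * M * q' * (1 - p)) := by
  have h1 : p * (1 - p) = 0 := by rw [mul_sub, hp, mul_one, sub_self]
  have h2 : (1 - p) * p = 0 := by rw [sub_mul, hp, one_mul, sub_self]
  rw [commute_iff_eq, mul_add, add_mul, mul_assoc _ (1 - p) p, h2, mul_assoc _ p p, hp]
  simp only [← mul_assoc, hp, h1, zero_mul, mul_zero]

section General

variable {ι : Type} [Fintype ι] [DecidableEq ι]

/-- `s` is a graded `*`-subalgebra of `A` on which `π` is multiplicative and linear, intertwines the
grading with `Γ`, and satisfies `π (a*) = (Ψ (π a))*`. -/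
structure IsGradedRep (s : Set A) (π : A → Matrix ι ι (Adjointable B E))
    (Γ Ψ : Matrix ι ι (Adjointable B E) →⋆ₐ[ℂ] Matrix ι ι (Adjointable B E)) : Prop where
  zero_mem : 0 ∈ s
  add_mem : ∀ {a b}, a ∈ s → b ∈ s → a + b ∈ s
  smul_mem : ∀ (c : ℂ) {a}, a ∈ s → c • a ∈ s
  mul_mem : ∀ {a b}, a ∈ s → b ∈ s → a * b ∈ s
  grad_mem : ∀ {a}, a ∈ s → X.gradA a ∈ s
  star_mem : ∀ {a}, a ∈ s → star a ∈ s
  map_add : ∀ {a b}, a ∈ s → b ∈ s → π (a + b) = π a + π b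
  map_smul : ∀ (c : ℂ) {a}, a ∈ s → π (c • a) = c • π a
  map_mul : ∀ {a b}, a ∈ s → b ∈ s → π (a * b) = π a * π b
  map_grad : ∀ {a}, a ∈ s → π (X.gradA a) = Γ (π a)
  map_star : ∀ {a}, a ∈ s → π (star a) = star (Ψ (π a))

variable (ι) in
/-- The grading automorphism of `End*_B(E)`, applied to matrices. -/
def gradMatrix : Matrix ι ι (Adjointable B E) →⋆ₐ[ℂ] Matrix ι ι (Adjointable B E) :=
  { X.gradEnd.toAlgHom.mapMatrix with
    map_star' := fun M => by
      ext1 i j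
      exact map_star X.gradEnd (M j i) }

@[simp] theorem gradMatrix_apply (M : Matrix ι ι (Adjointable B E)) (i j : ι) :
    X.gradMatrix ι M i j = X.gradEnd (M i j) := rfl

theorem gradMatrix_injective : Function.Injective (X.gradMatrix ι) := by
  intro M N h
  ext1 i j
  have := congrArg X.gradEnd (congrFun (congrFun h i) j)
  simpa [X.gradEnd_gradEnd] using this

theorem gradMatrix_continuous : Continuous (X.gradMatrix ι) := by
  have h : Continuous X.gradEnd := by
    refine AddMonoidHomClass.continuous_of_bound X.gradEnd 1 fun T => ?_
    rw [one_mul]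
    exact NonUnitalStarAlgHom.norm_apply_le X.gradEnd T
  exact continuous_id.matrix_map h

theorem isSymmetry_gradMatrix : X.IsSymmetry (X.gradMatrix ι) (-1) where
  map_res := by
    ext1 i j
    obtain rfl | h := eq_or_ne i j
    · simp [X.gradEnd_res_dres.1]
    · simp [h]
  map_dres := by
    ext1 i j
    obtain rfl | h := eq_or_ne i j
    · simp [X.gradEnd_res_dres.2, Units.neg_smul]
    · simp [h]
  map_commutator h i j := by
    simpa [Units.neg_smul] using X.isTwistedCommutator_gradEnd (h i j)

theorem isGradedRep_base : X.IsGradedRep Set.univ (fun a (_ _ : Unit) => X.φ a)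
    (X.gradMatrix Unit) (StarAlgHom.id ℂ _) where
  zero_mem := trivial
  add_mem _ _ := trivial
  smul_mem _ _ _ := trivial
  mul_mem _ _ := trivial
  grad_mem _ := trivial
  star_mem _ := trivial
  map_add _ _ := by ext1 i j; exact _root_.map_add X.φ _ _
  map_smul c a _ := by ext1 i j; exact _root_.map_smul X.φ c a
  map_mul {a b} _ _ := by
    ext1 i j
    change X.φ (a * b) = ∑ _ : Unit, X.φ a * X.φ b
    simp
  map_grad _ := by ext1 i j; exact X.φ_gradA_eq _
  map_star _ := by ext1 i j; exact StarHomClass.map_star X.φ _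

/-- The block matrix with rows `θ(a), 0` and `[D, θ(a)], θ(γ(a))`. -/
def commutatorRep (θ : A → Matrix ι ι (Adjointable B E)) (a : A) :
    Matrix (ι ⊕ ι) (ι ⊕ ι) (Adjointable B E) :=
  fromBlocks (θ a) 0 (twistedCommutator X.D (θ a) (θ (X.gradA a))) (θ (X.gradA a))

/-- The elements of `s` with adjointable graded commutator. -/
def commutatorDomain (s : Set A) (θ : A → Matrix ι ι (Adjointable B E)) : Set A :=
  {a | a ∈ s ∧ HasTwistedCommutator X.D (θ a) (θ (X.gradA a))}

variable {X}

theorem isMatrixCommutator_of_mem {s : Set A} {θ : A → Matrix ι ι (Adjointable B E)} {a : A}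
    (h : a ∈ X.commutatorDomain s θ) : IsMatrixCommutator X.D (θ a) (θ (X.gradA a))
      (twistedCommutator X.D (θ a) (θ (X.gradA a))) :=
  h.2.isMatrixCommutator

variable {s : Set A} {θ : A → Matrix ι ι (Adjointable B E)}
  {Γ Ψ : Matrix ι ι (Adjointable B E) →⋆ₐ[ℂ] Matrix ι ι (Adjointable B E)} {ε : ℤˣ}

/-- `twistedCommutator` is a choice, so any exhibited commutator relation determines it by
uniqueness. Each closure property below reduces to exhibiting one relation. -/
theorem commutatorRep_eq {a : A} {T T' S : Matrix ι ι (Adjointable B E)}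
    (h : IsMatrixCommutator X.D T T' S) (hT : θ a = T) (hT' : θ (X.gradA a) = T') :
    HasTwistedCommutator X.D (θ a) (θ (X.gradA a)) ∧
      X.commutatorRep θ a = fromBlocks T 0 S T' := by
  subst hT hT'
  exact ⟨h.has, by rw [commutatorRep, h.twistedCommutator_eq X.regular.1]⟩

namespace IsGradedRep

theorem commutator_zero (h : X.IsGradedRep s θ Γ Ψ) :
    HasTwistedCommutator X.D (θ 0) (θ (X.gradA 0)) := by
  have h0 : θ 0 = 0 := by simpa using h.map_smul 0 h.zero_mem
  rw [_root_.map_zero, h0]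
  exact IsMatrixCommutator.zero.has

theorem commutator_add (h : X.IsGradedRep s θ Γ Ψ) {a b : A} (ha : a ∈ X.commutatorDomain s θ)
    (hb : b ∈ X.commutatorDomain s θ) :
    HasTwistedCommutator X.D (θ (a + b)) (θ (X.gradA (a + b))) ∧
      X.commutatorRep θ (a + b) = X.commutatorRep θ a + X.commutatorRep θ b := by
  have := commutatorRep_eq (a := a + b)
    ((isMatrixCommutator_of_mem ha).add (isMatrixCommutator_of_mem hb))
    (h.map_add ha.1 hb.1)
    (by rw [_root_.map_add, h.map_add (h.grad_mem ha.1) (h.grad_mem hb.1)])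
  exact ⟨this.1, by rw [this.2]; simp [commutatorRep, fromBlocks_add]⟩

theorem commutator_smul (h : X.IsGradedRep s θ Γ Ψ) (c : ℂ) {a : A}
    (ha : a ∈ X.commutatorDomain s θ) :
    HasTwistedCommutator X.D (θ (c • a)) (θ (X.gradA (c • a))) ∧
      X.commutatorRep θ (c • a) = c • X.commutatorRep θ a := by
  have := commutatorRep_eq (a := c • a)
    ((isMatrixCommutator_of_mem ha).smul c)
    (h.map_smul c ha.1)
    (by rw [_root_.map_smul, h.map_smul c (h.grad_mem ha.1)])
  exact ⟨this.1, by rw [this.2]; simp [commutatorRep, fromBlocks_smul]⟩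

theorem commutator_mul (h : X.IsGradedRep s θ Γ Ψ) {a b : A} (ha : a ∈ X.commutatorDomain s θ)
    (hb : b ∈ X.commutatorDomain s θ) :
    HasTwistedCommutator X.D (θ (a * b)) (θ (X.gradA (a * b))) ∧
      X.commutatorRep θ (a * b) = X.commutatorRep θ a * X.commutatorRep θ b := by
  have := commutatorRep_eq (a := a * b)
    ((isMatrixCommutator_of_mem ha).mul (isMatrixCommutator_of_mem hb))
    (h.map_mul ha.1 hb.1)
    (by rw [_root_.map_mul, h.map_mul (h.grad_mem ha.1) (h.grad_mem hb.1)])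
  exact ⟨this.1, by rw [this.2]; simp [commutatorRep, fromBlocks_multiply]⟩

theorem commutator_grad (h : X.IsGradedRep s θ Γ Ψ) (hΓ : X.IsSymmetry Γ (-1)) {a : A}
    (ha : a ∈ X.commutatorDomain s θ) :
    HasTwistedCommutator X.D (θ (X.gradA a)) (θ (X.gradA (X.gradA a))) ∧
      X.commutatorRep θ (X.gradA a) = blockHom Γ (-1) (X.commutatorRep θ a) := by
  have := commutatorRep_eq (a := X.gradA a)
    (hΓ.map_commutator (isMatrixCommutator_of_mem ha))
    (h.map_grad ha.1) (h.map_grad (h.grad_mem ha.1))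
  exact ⟨this.1, by rw [this.2]; simp [commutatorRep]⟩

/-- Apply `Γ`, then `Ψ`, then the adjoint to `D θ(a) - θ(γ a) D = S`. `Γ` exchanges `θ(a)` and `θ(γ
a)`, undoing their exchange by the adjoint, and its sign cancels the sign from the adjoint. What
remains is `D θ(a*) - θ(γ a*) D = ε (Ψ Γ S)*`. -/
theorem commutator_star (h : X.IsGradedRep s θ Γ Ψ) (hΓ : X.IsSymmetry Γ (-1))
    (hΨ : X.IsSymmetry Ψ ε) {a : A} (ha : a ∈ X.commutatorDomain s θ) :
    HasTwistedCommutator X.D (θ (star a)) (θ (X.gradA (star a))) ∧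
      X.commutatorRep θ (star a) =
        star (blockSwapHom (Ψ.comp Γ) ε (X.commutatorRep θ a)) := by
  have hg : Γ (θ (X.gradA a)) = θ a := by rw [← h.map_grad (h.grad_mem ha.1), X.gradA_gradA]
  have hc := (hΨ.map_commutator (hΓ.map_commutator (isMatrixCommutator_of_mem ha))).star
    X.regular.1 X.selfAdjoint
  rw [hg, ← h.map_grad ha.1] at hc
  have := commutatorRep_eq (a := star a) hc (h.map_star ha.1)
    (by rw [X.gradA_star, h.map_star (h.grad_mem ha.1)])
  refine ⟨this.1, ?_⟩
  rw [this.2, commutatorRep, blockSwapHom_fromBlocks]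
  simp only [star_eq_conjTranspose, fromBlocks_conjTranspose, StarAlgHom.comp_apply, hg,
    ← h.map_grad ha.1, _root_.map_zero, smul_zero, conjTranspose_zero]
  congr 1
  simp [Units.neg_smul, conjTranspose_neg]

theorem commutatorRep (h : X.IsGradedRep s θ Γ Ψ) (hΓ : X.IsSymmetry Γ (-1))
    (hΨ : X.IsSymmetry Ψ ε) :
    X.IsGradedRep (X.commutatorDomain s θ) (X.commutatorRep θ) (blockHom Γ (-1))
      (blockSwapHom (Ψ.comp Γ) ε) where
  zero_mem := ⟨h.zero_mem, h.commutator_zero⟩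
  add_mem ha hb := ⟨h.add_mem ha.1 hb.1, (h.commutator_add ha hb).1⟩
  smul_mem c _ ha := ⟨h.smul_mem c ha.1, (h.commutator_smul c ha).1⟩
  mul_mem ha hb := ⟨h.mul_mem ha.1 hb.1, (h.commutator_mul ha hb).1⟩
  grad_mem ha := ⟨h.grad_mem ha.1, (h.commutator_grad hΓ ha).1⟩
  star_mem ha := ⟨h.star_mem ha.1, (h.commutator_star hΓ hΨ ha).1⟩
  map_add ha hb := (h.commutator_add ha hb).2
  map_smul c _ ha := (h.commutator_smul c ha).2
  map_mul ha hb := (h.commutator_mul ha hb).2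
  map_grad ha := (h.commutator_grad hΓ ha).2
  map_star ha := (h.commutator_star hΓ hΨ ha).2

/-- The compression of a representation to two complementary invariant subspaces. -/
theorem compress {π : A → Matrix ι ι (Adjointable B E)} (h : X.IsGradedRep s π Γ Ψ)
    {e f : Matrix ι ι (Adjointable B E)}
    (hef : e * f = 0) (hfe : f * e = 0) (hse : star e = e) (hsf : star f = f)
    (hΓe : Γ e = e) (hΓf : Γ f = f) (hΨe : Ψ e = f) (hΨf : Ψ f = e)
    (hπe : ∀ a ∈ s, e * π a * e = π a * e) (hπf : ∀ a ∈ s, f * π a * f = f * π a) :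
    X.IsGradedRep s (fun a => e * π a * e + f * π a * f) Γ Ψ where
  zero_mem := h.zero_mem
  add_mem := h.add_mem
  smul_mem := h.smul_mem
  mul_mem := h.mul_mem
  grad_mem := h.grad_mem
  star_mem := h.star_mem
  map_add ha hb := by
    simp only [h.map_add ha hb]
    noncomm_ring
  map_smul c _ ha := by simp [h.map_smul c ha]
  map_mul {a b} ha hb := by
    simp only [h.map_mul ha hb]
    -- The range of `e` is invariant, so the middle `e` is absorbed on the right by `π b * e`;
    -- below, `f` is absorbed on the left by `f * π a`.
    have h1 : e * π a * e * (e * π b * e) = e * (π a * π b) * e := by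
      calc e * π a * e * (e * π b * e) = e * π a * (e * (e * π b * e)) := by noncomm_ring
        _ = e * π a * (e * π b * e) := by rw [hπe b hb, ← mul_assoc e, hπe b hb]
        _ = e * (π a * π b) * e := by rw [hπe b hb]; noncomm_ring
    have h2 : f * π a * f * (f * π b * f) = f * (π a * π b) * f := by
      calc f * π a * f * (f * π b * f) = f * π a * f * f * (π b * f) := by noncomm_ring
        _ = f * π a * (π b * f) := by rw [hπf a ha, hπf a ha]
        _ = f * (π a * π b) * f := by noncomm_ring
    have h3 : e * π a * e * (f * π b * f) = 0 := by
      calc _ = e * π a * (e * f) * (π b * f) := by noncomm_ring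
        _ = 0 := by rw [hef]; simp
    have h4 : f * π a * f * (e * π b * e) = 0 := by
      calc _ = f * π a * (f * e) * (π b * e) := by noncomm_ring
        _ = 0 := by rw [hfe]; simp
    rw [add_mul, mul_add, mul_add, h1, h2, h3, h4]
    simp
  map_grad ha := by simp [h.map_grad ha, hΓe, hΓf]
  -- `Ψ` exchanges `e` and `f`, so the two compressions trade places, whence the final `add_comm`.
  map_star ha := by
    simp only [h.map_star ha, _root_.map_add, _root_.map_mul, hΨe, hΨf, star_add, star_mul, hse,
      hsf, mul_assoc]
    rw [add_comm]

/-- The maps `θ_{n+1}` in terms of `π_{n+1}`, the projection `p` onto the graph and two projections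
`q`, `q'` that commute with `p` and `π_{n+1}`. -/
theorem compress_graphProj (h : X.IsGradedRep s θ Γ Ψ) (hΓ : X.IsSymmetry Γ (-1))
    (hΨ : X.IsSymmetry Ψ ε) {q q' : Matrix (ι ⊕ ι) (ι ⊕ ι) (Adjointable B E)}
    (hq : q * q = q) (hq' : q' * q' = q') (hs : star q = q) (hs' : star q' = q')
    (hc : Commute q (X.graphProj ι)) (hc' : Commute q' (X.graphProj ι))
    (hπ : ∀ a ∈ X.commutatorDomain s θ, Commute q (X.commutatorRep θ a))
    (hπ' : ∀ a ∈ X.commutatorDomain s θ, Commute q' (X.commutatorRep θ a))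
    (hΓq : blockHom Γ (-1) q = q) (hΓq' : blockHom Γ (-1) q' = q')
    (hΨq : blockSwapHom (Ψ.comp Γ) ε q = q') (hΨq' : blockSwapHom (Ψ.comp Γ) ε q' = q) :
    X.IsGradedRep (X.commutatorDomain s θ)
      (fun a => X.graphProj ι * q * X.commutatorRep θ a * q * X.graphProj ι +
        (1 - X.graphProj ι) * q' * X.commutatorRep θ a * q' * (1 - X.graphProj ι))
      (blockHom Γ (-1)) (blockSwapHom (Ψ.comp Γ) ε) := by
  set p := X.graphProj ι with hp
  have hpp : p * p = p := X.graphProj_mul_self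
  have hsp : star p = p := X.star_graphProj
  have hp1 : p * (1 - p) = 0 := by rw [mul_sub, hpp]; simp
  have hp2 : (1 - p) * p = 0 := by rw [sub_mul, hpp]; simp
  have hp3 : (1 - p) * (1 - p) = 1 - p := by rw [mul_sub, hp2]; simp
  have hcq : Commute q' (1 - p) := (Commute.one_right _).sub_right hc'
  have hΓp : blockHom Γ (-1) p = p := hΓ.blockHom_graphProj
  have hΨp : blockSwapHom (Ψ.comp Γ) ε p = 1 - p :=
    IsSymmetry.blockSwapHom_graphProj (by simpa using hΨ.comp hΓ)
  have hinv : ∀ a ∈ X.commutatorDomain s θ,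
      p * X.commutatorRep θ a * p = X.commutatorRep θ a * p := fun a ha =>
    graphProj_mul_mul (isMatrixCommutator_of_mem ha)
  -- Invariance of the range of `p` is equivalent to this dual identity for `1 - p`.
  have hinv' : ∀ a ∈ X.commutatorDomain s θ,
      (1 - p) * X.commutatorRep θ a * (1 - p) = (1 - p) * X.commutatorRep θ a := fun a ha => by
    rw [mul_sub, mul_one, sub_eq_self, sub_mul, sub_mul, hinv a ha, one_mul, sub_self]
  have key := (h.commutatorRep hΓ hΨ).compress (e := p * q) (f := (1 - p) * q')
    (by rw [← hc.eq, mul_assoc, ← mul_assoc p, hp1]; simp)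
    (by rw [← hcq.eq, mul_assoc, ← mul_assoc (1 - p), hp2]; simp)
    (by rw [star_mul, hs, hsp, hc.eq])
    (by rw [star_mul, star_sub, star_one, hs', hsp, hcq.eq])
    (by rw [_root_.map_mul, hΓp, hΓq])
    (by rw [_root_.map_mul, map_sub, map_one, hΓp, hΓq'])
    (by rw [_root_.map_mul, hΨp, hΨq])
    (by rw [_root_.map_mul, map_sub, map_one, hΨp, hΨq', sub_sub_cancel])
    (fun a ha => by
      calc p * q * X.commutatorRep θ a * (p * q)
          = p * (q * X.commutatorRep θ a) * p * q := by noncomm_ring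
        _ = p * X.commutatorRep θ a * (q * p) * q := by rw [(hπ a ha).eq]; noncomm_ring
        _ = p * X.commutatorRep θ a * p * (q * q) := by rw [hc.eq]; noncomm_ring
        _ = _ := by rw [hinv a ha, hq]; noncomm_ring)
    (fun a ha => by
      calc (1 - p) * q' * X.commutatorRep θ a * ((1 - p) * q')
          = (1 - p) * (q' * X.commutatorRep θ a) * ((1 - p) * q') := by noncomm_ring
        _ = (1 - p) * X.commutatorRep θ a * (q' * (1 - p)) * q' := by
          rw [(hπ' a ha).eq]; noncomm_ring
        _ = (1 - p) * X.commutatorRep θ a * (1 - p) * (q' * q') := by rw [hcq.eq]; noncomm_ring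
        _ = (1 - p) * (X.commutatorRep θ a * q') := by rw [hinv' a ha, hq']; noncomm_ring
        _ = _ := by rw [← (hπ' a ha).eq]; noncomm_ring)
  -- The compression is by `p * q` on both sides; commutation of `q` with `p` gives the palindromic
  -- order `p q ⋯ q p`.
  convert key using 3 with a
  · rw [← hc.eq]
    simp only [mul_assoc, hc.eq]
  · rw [← hcq.eq]
    simp only [mul_assoc, hcq.eq]

end IsGradedRep

theorem commute_fromBlocks_commutatorRep (h : X.IsGradedRep s θ Γ Ψ)
    {w : Matrix ι ι (Adjointable B E)} (hw : IsMatrixCommutator X.D w w 0)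
    (hwθ : ∀ a ∈ s, Commute w (θ a)) {a : A} (ha : a ∈ X.commutatorDomain s θ) :
    Commute (fromBlocks w 0 0 w) (X.commutatorRep θ a) := by
  have h1 := hwθ a ha.1
  have h2 := hwθ _ (h.grad_mem ha.1)
  have h3 := (isMatrixCommutator_of_mem ha).commute X.regular.1 hw h1 h2
  rw [commute_iff_eq, commutatorRep]
  simp [fromBlocks_multiply, h1.eq, h2.eq, h3.eq]

namespace IsGradedRep

/-- At the first level there is no earlier projection, so `q = q' = 1`. -/
theorem compress_one (h : X.IsGradedRep s θ Γ Ψ) (hΓ : X.IsSymmetry Γ (-1))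
    (hΨ : X.IsSymmetry Ψ ε) {p : Matrix (ι ⊕ ι) (ι ⊕ ι) (Adjointable B E)}
    (hp : p = X.graphProj ι) :
    X.IsGradedRep (X.commutatorDomain s θ)
      (fun a => p * X.commutatorRep θ a * p + (1 - p) * X.commutatorRep θ a * (1 - p))
      (blockHom Γ (-1)) (blockSwapHom (Ψ.comp Γ) ε) := by
  have h := h.compress_graphProj (q := 1) (q' := 1) hΓ hΨ (mul_one _) (mul_one _) (star_one _)
    (star_one _) (Commute.one_left _) (Commute.one_left _) (fun _ _ => Commute.one_left _)
    (fun _ _ => Commute.one_left _) (map_one _) (map_one _) (map_one _) (map_one _)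
  simpa only [mul_one, ← hp] using h

/-- Here `q = r ⊕ r` and `q' = 1 - q`. The star automorphism of the lower level sends `r` to `1 -
r`, and the flip preserves a diagonal with equal blocks, so `q` goes to `1 - q`. The sign of the
star automorphism alternates from level to level, hence `-ε`. -/
theorem compress_two {θ : A → Matrix (ι ⊕ ι) (ι ⊕ ι) (Adjointable B E)}
    (h : X.IsGradedRep s θ (blockHom Γ (-1)) (blockSwapHom (Ψ.comp Γ) ε))
    (hΓ : X.IsSymmetry Γ (-1)) (hΨ : X.IsSymmetry Ψ ε)
    {r : Matrix (ι ⊕ ι) (ι ⊕ ι) (Adjointable B E)} (hr : r = X.graphProj ι)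
    {p : Matrix ((ι ⊕ ι) ⊕ (ι ⊕ ι)) ((ι ⊕ ι) ⊕ (ι ⊕ ι)) (Adjointable B E)}
    (hp : p = X.graphProj (ι ⊕ ι)) {q : Matrix ((ι ⊕ ι) ⊕ (ι ⊕ ι)) ((ι ⊕ ι) ⊕ (ι ⊕ ι))
      (Adjointable B E)} (hq : q = fromBlocks r 0 0 r) (hc : ∀ a ∈ s, Commute r (θ a)) :
    X.IsGradedRep (X.commutatorDomain s θ)
      (fun a => p * q * X.commutatorRep θ a * q * p +
        (1 - p) * (1 - q) * X.commutatorRep θ a * (1 - q) * (1 - p))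
      (blockHom (blockHom Γ (-1)) (-1))
      (blockSwapHom ((blockSwapHom (Ψ.comp Γ) ε).comp (blockHom Γ (-1))) (-ε)) := by
  have hsym : X.IsSymmetry (Ψ.comp Γ) (-ε) := by simpa using hΨ.comp hΓ
  have hrr : r * r = r := by rw [hr]; exact X.graphProj_mul_self
  have hsr : star r = r := by rw [hr]; exact X.star_graphProj
  have hΓr : blockHom Γ (-1) r = r := by rw [hr]; exact hΓ.blockHom_graphProj
  have hΨr : blockSwapHom (Ψ.comp Γ) ε r = 1 - r := by
    rw [hr]; exact hsym.blockSwapHom_graphProj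
  have hqq : q * q = q := by
    rw [hq, fromBlocks_multiply]
    simp [hrr]
  have hsq : star q = q := by
    rw [hq, star_eq_conjTranspose, fromBlocks_conjTranspose, ← star_eq_conjTranspose, hsr]
    simp
  have hcq : Commute q (X.graphProj (ι ⊕ ι)) := by
    rw [hq, hr]
    exact X.commute_graphProj_ext
  have hπ : ∀ a ∈ X.commutatorDomain s θ, Commute q (X.commutatorRep θ a) := fun a ha => by
    rw [hq]
    refine commute_fromBlocks_commutatorRep h ?_ hc ha
    rw [hr]
    exact X.graphProj_isMatrixCommutator
  have hΓq : blockHom (blockHom Γ (-1)) (-1) q = q := by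
    rw [hq, blockHom_fromBlocks, hΓr, _root_.map_zero, smul_zero]
  have hΨq : blockSwapHom ((blockSwapHom (Ψ.comp Γ) ε).comp (blockHom Γ (-1))) (-ε) q =
      1 - q := by
    have h1 : (1 : Matrix ((ι ⊕ ι) ⊕ (ι ⊕ ι)) ((ι ⊕ ι) ⊕ (ι ⊕ ι)) (Adjointable B E)) =
      fromBlocks 1 0 0 1 := fromBlocks_one.symm
    rw [hq, blockSwapHom_fromBlocks, StarAlgHom.comp_apply, StarAlgHom.comp_apply, hΓr, hΨr,
      _root_.map_zero, _root_.map_zero, smul_zero, h1, sub_eq_add_neg, sub_eq_add_neg,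
      fromBlocks_neg, fromBlocks_add]
    simp only [neg_zero, add_zero]
  have h := h.compress_graphProj (q := q) (q' := 1 - q) (hΓ.blockHom (-1))
    (hsym.blockSwapHom ε) hqq
    (by rw [sub_mul, one_mul, mul_sub, mul_one, hqq, sub_self, sub_zero]) hsq
    (by rw [star_sub, star_one, hsq]) hcq ((Commute.one_left _).sub_left hcq) hπ
    (fun a ha => (Commute.one_left _).sub_left (hπ a ha)) hΓq (by rw [map_sub, map_one, hΓq])
    hΨq (by rw [map_sub, map_one, hΨq, sub_sub_cancel])
  rwa [← hp] at h

end IsGradedRep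

end General

end UnboundedBimodule

/-! ### The induction over the Sobolev levels and the passage to limits. -/

namespace UnboundedBimodule

variable {A B E : Type*} [NonUnitalCStarAlgebra A] [NonUnitalCStarAlgebra B]
  [PartialOrder B] [StarOrderedRing B] [NormedAddCommGroup E] [NormedSpace ℂ E] [CompleteSpace E]
  [SMul B E] [CStarModule B E] (X : UnboundedBimodule A B E)

open Matrix

/-- The grading automorphism of `End*_B(E_n)`. -/
def gradAut : (n : ℕ) → Matrix (SobIdx n) (SobIdx n) (Adjointable B E) →⋆ₐ[ℂ]
    Matrix (SobIdx n) (SobIdx n) (Adjointable B E)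
  | 0 => X.gradMatrix Unit
  | n + 1 => blockHom (gradAut n) (-1)

/-- The automorphism `Ψ_n` of `End*_B(E_n)` with `π_n(a*) = Ψ_n(π_n(a))*` for `a` in `A_n`. -/
def starAut : (n : ℕ) → Matrix (SobIdx n) (SobIdx n) (Adjointable B E) →⋆ₐ[ℂ]
    Matrix (SobIdx n) (SobIdx n) (Adjointable B E)
  | 0 => StarAlgHom.id ℂ (Matrix Unit Unit (Adjointable B E))
  | n + 1 => blockSwapHom ((starAut n).comp (X.gradAut n)) ((-1) ^ n)

theorem isSymmetry_gradAut : ∀ n, X.IsSymmetry (X.gradAut n) (-1)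
  | 0 => X.isSymmetry_gradMatrix (ι := Unit)
  | n + 1 => (isSymmetry_gradAut n).blockHom (-1)

theorem isSymmetry_starAut : ∀ n, X.IsSymmetry (X.starAut n) ((-1) ^ n)
  | 0 => IsSymmetry.id (X := X) (ι := Unit)
  | n + 1 => by
    rw [pow_succ]
    exact ((isSymmetry_starAut n).comp (X.isSymmetry_gradAut n)).blockSwapHom ((-1) ^ n)

theorem gradAut_injective : ∀ n, Function.Injective (X.gradAut n)
  | 0 => X.gradMatrix_injective (ι := Unit)
  | n + 1 => blockHom_injective (gradAut_injective n) (-1)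

theorem starAut_injective : ∀ n, Function.Injective (X.starAut n)
  | 0 => Function.injective_id
  | n + 1 => blockSwapHom_injective (Φ := (X.starAut n).comp (X.gradAut n))
      ((starAut_injective n).comp (X.gradAut_injective n)) ((-1) ^ n)

theorem gradAut_continuous : ∀ n, Continuous (X.gradAut n)
  | 0 => X.gradMatrix_continuous (ι := Unit)
  | n + 1 => blockHom_continuous (gradAut_continuous n) (-1)

theorem woronowicz_eq (n : ℕ) : X.woronowicz n = X.graphProj (SobIdx n) := by
  unfold woronowicz graphProj
  rw [X.leftComp_dres, ← Matrix.diagonal_one, Matrix.diagonal_sub]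
  rfl

theorem woronowicz_mul_self (n : ℕ) : X.woronowicz n * X.woronowicz n = X.woronowicz n := by
  rw [woronowicz_eq]
  exact X.graphProj_mul_self

theorem theta_zero : X.theta 0 = fun a _ _ => X.φ a := by
  funext a
  rw [theta]

theorem theta_one : X.theta 1 = fun a =>
    X.woronowicz 0 * X.piStep (X.theta 0) a * X.woronowicz 0 +
      (1 - X.woronowicz 0) * X.piStep (X.theta 0) a * (1 - X.woronowicz 0) := by
  funext a
  rw [theta]

theorem theta_add_two (n : ℕ) : X.theta (n + 2) = fun a =>
    X.woronowicz (n + 1) * X.woronowiczExt n * X.piStep (X.theta (n + 1)) a *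
        X.woronowiczExt n * X.woronowicz (n + 1) +
      (1 - X.woronowicz (n + 1)) * (1 - X.woronowiczExt n) * X.piStep (X.theta (n + 1)) a *
        (1 - X.woronowiczExt n) * (1 - X.woronowicz (n + 1)) := by
  funext a
  rw [theta]

theorem commute_woronowicz_theta (n : ℕ) (a : A) :
    Commute (X.woronowicz n) (X.theta (n + 1) a) := by
  cases n with
  | zero =>
    rw [theta_one]
    simpa only [mul_one] using
      commute_compress (X.woronowicz_mul_self 0) 1 1 (X.piStep (X.theta 0) a)
  | succ n =>
    rw [theta_add_two]
    exact commute_compress (X.woronowicz_mul_self (n + 1)) _ _ _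

/-- The induction runs over `θ_n`, since both the next domain and `π_{n+1}` are made from it. The
first compression is separate because only later ones involve a previous projection. -/
theorem isGradedRep_theta (n : ℕ) :
    X.IsGradedRep (X.sobolev n) (X.theta n) (X.gradAut n) (X.starAut n) := by
  induction n with
  | zero =>
    rw [theta_zero]
    exact X.isGradedRep_base
  | succ n ih =>
    cases n with
    | zero =>
      rw [theta_one]
      exact ih.compress_one (X.isSymmetry_gradAut 0) (X.isSymmetry_starAut 0) (X.woronowicz_eq 0)
    | succ n =>
      rw [theta_add_two]
      have h := IsGradedRep.compress_two (ι := SobIdx n) (r := X.woronowicz n)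
        (p := X.woronowicz (n + 1)) (q := X.woronowiczExt n) ih
        (X.isSymmetry_gradAut n) (X.isSymmetry_starAut n) (X.woronowicz_eq n)
        (X.woronowicz_eq (n + 1)) rfl fun a _ => X.commute_woronowicz_theta n a
      have hε : -(-1 : ℤˣ) ^ n = (-1) ^ (n + 1) := by rw [pow_succ]; simp
      rw [hε] at h
      exact h

theorem isGradedRep_rep : ∀ n, X.IsGradedRep (X.sobolev n) (X.rep n) (X.gradAut n) (X.starAut n)
  | 0 => X.isGradedRep_theta 0
  | n + 1 => (X.isGradedRep_theta n).commutatorRep (X.isSymmetry_gradAut n) (X.isSymmetry_starAut n)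

theorem sobolev_antitone : Antitone X.sobolev :=
  antitone_nat_of_succ_le fun _ _ h => h.1

/-- `θ_n` is a continuous function of `π_n`. -/
theorem exists_theta_eq (n : ℕ) : ∃ F : Matrix (SobIdx n) (SobIdx n) (Adjointable B E) →
    Matrix (SobIdx n) (SobIdx n) (Adjointable B E), Continuous F ∧
      ∀ a, X.theta n a = F (X.rep n a) := by
  cases n with
  | zero => exact ⟨id, continuous_id, fun _ => rfl⟩
  | succ n =>
    cases n with
    | zero =>
      rw [theta_one]
      refine ⟨fun M => X.woronowicz 0 * M * X.woronowicz 0 +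
        (1 - X.woronowicz 0) * M * (1 - X.woronowicz 0), ?_, fun _ => rfl⟩
      exact ((continuous_const.mul continuous_id).mul continuous_const).add
          ((continuous_const.mul continuous_id).mul continuous_const)
    | succ n =>
      rw [theta_add_two]
      refine ⟨fun M => X.woronowicz (n + 1) * X.woronowiczExt n * M *
          X.woronowiczExt n * X.woronowicz (n + 1) +
        (1 - X.woronowicz (n + 1)) * (1 - X.woronowiczExt n) * M *
          (1 - X.woronowiczExt n) * (1 - X.woronowicz (n + 1)), ?_, fun _ => rfl⟩
      exact (((continuous_const.mul continuous_id).mul continuous_const).mul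
        continuous_const).add (((continuous_const.mul continuous_id).mul continuous_const).mul
        continuous_const)

/-- The limit of a net in `A_n` lies in `A_n`, if its images under the `π_j` converge. -/
theorem mem_sobolev_of_tendsto {κ : Type*} {l : Filter κ} [l.NeBot] {u : κ → A} {a : A} (n : ℕ)
    (hu : ∀ k, u k ∈ X.sobolev n) (h0 : Filter.Tendsto (fun k => X.rep 0 (u k)) l (nhds (X.rep 0 a)))
    (T : (j : ℕ) → Matrix (SobIdx j) (SobIdx j) (Adjointable B E))
    (hT : ∀ j ≤ n, Filter.Tendsto (fun k => X.rep j (u k)) l (nhds (T j))) :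
    a ∈ X.sobolev n ∧ ∀ j ≤ n, X.rep j a = T j := by
  induction n with
  | zero =>
    refine ⟨trivial, fun j hj => ?_⟩
    obtain rfl : j = 0 := Nat.le_zero.1 hj
    exact tendsto_nhds_unique h0 (hT 0 le_rfl)
  | succ n ih =>
    obtain ⟨ha, hj⟩ := ih (fun k => (hu k).1) (fun j hj => hT j (hj.trans n.le_succ))
    have hn := hT n n.le_succ
    rw [← hj n le_rfl] at hn
    obtain ⟨F, hF, hFθ⟩ := X.exists_theta_eq n
    have hθ : Filter.Tendsto (fun k => X.theta n (u k)) l (nhds (X.theta n a)) := by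
      simp only [hFθ]
      exact (hF.tendsto _).comp hn
    have hθ' : Filter.Tendsto (fun k => X.theta n (X.gradA (u k))) l
        (nhds (X.theta n (X.gradA a))) := by
      rw [(X.isGradedRep_theta n).map_grad ha]
      simp only [(X.isGradedRep_theta n).map_grad (hu _).1]
      exact ((X.gradAut_continuous n).tendsto _).comp hθ
    -- The commutator is the lower left block of `π_{n+1}`, so its convergence is part of the
    -- assumption.
    have hS : Filter.Tendsto
        (fun k => twistedCommutator X.D (X.theta n (u k)) (X.theta n (X.gradA (u k)))) l
        (nhds ((T (n + 1)).submatrix Sum.inr Sum.inl)) :=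
      ((continuous_id.matrix_submatrix (Sum.inr : SobIdx n → SobIdx n ⊕ SobIdx n)
        (Sum.inl : SobIdx n → SobIdx n ⊕ SobIdx n)).tendsto _).comp (hT (n + 1) le_rfl)
    -- Closedness of `D` puts the limit in the domain of the commutator and identifies its value.
    have hC := IsMatrixCommutator.of_tendsto X.regular.2.1 hθ hθ' hS fun k =>
      (hu k).2.isMatrixCommutator
    refine ⟨⟨ha, hC.has⟩, fun j hjn => ?_⟩
    obtain hlt | rfl := Nat.lt_or_eq_of_le hjn
    · exact hj j (Nat.lt_succ_iff.1 hlt)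
    · refine tendsto_nhds_unique ?_ (hT (n + 1) le_rfl)
      have : X.rep (n + 1) a = fromBlocks (X.theta n a) 0
          ((T (n + 1)).submatrix Sum.inr Sum.inl) (X.theta n (X.gradA a)) :=
        (commutatorRep_eq hC rfl rfl).2
      rw [this]
      have hb : Continuous fun M : Matrix (SobIdx n) (SobIdx n) (Adjointable B E) ×
          Matrix (SobIdx n) (SobIdx n) (Adjointable B E) ×
          Matrix (SobIdx n) (SobIdx n) (Adjointable B E) => fromBlocks M.1 0 M.2.1 M.2.2 :=
        Continuous.matrix_fromBlocks (by fun_prop) (by fun_prop) (by fun_prop) (by fun_prop)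
      exact (hb.tendsto (_, _, _)).comp (hθ.prodMk_nhds (hS.prodMk_nhds hθ'))

end UnboundedBimodule

/-! ### Matrix norms -/

section MatrixNorms

variable {C : Type*} [NonUnitalCStarAlgebra C]

/-- A matrix acts on row vectors from the right, so a product becomes a composition in reverse order
and the operator norm is submultiplicative, also for rectangular matrices. -/
theorem CStarMatrix.norm_mul_le_mul_norm {C : Type*} [NonUnitalCStarAlgebra C] [PartialOrder C]
    [StarOrderedRing C] {l m n : Type*} [Fintype l] [Fintype m] [Fintype n]
    (M : CStarMatrix l m C) (N : CStarMatrix m n C) : ‖M * N‖ ≤ ‖M‖ * ‖N‖ := by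
  have h : CStarMatrix.toCLM (M * N) =
      (CStarMatrix.toCLM N).comp (CStarMatrix.toCLM M) := by
    ext v i
    simp only [CStarMatrix.toCLM_apply, ContinuousLinearMap.comp_apply]
    exact congrFun (Matrix.vecMul_vecMul v M N).symm i
  rw [CStarMatrix.norm_def, h, mul_comm]
  exact ContinuousLinearMap.opNorm_comp_le _ _

theorem cstarMatrixNorm_mul_le {l m n : Type} [Fintype l] [Fintype m] [Fintype n]
    (M : Matrix l m C) (N : Matrix m n C) :
    cstarMatrixNorm (M * N) ≤ cstarMatrixNorm M * cstarMatrixNorm N := by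
  let _ : PartialOrder C := CStarAlgebra.spectralOrder C
  let _ : StarOrderedRing C := CStarAlgebra.spectralOrderedRing C
  exact CStarMatrix.norm_mul_le_mul_norm (CStarMatrix.ofMatrix M) (CStarMatrix.ofMatrix N)

theorem cstarMatrixNorm_conjTranspose {n : Type} [Fintype n] (M : Matrix n n C) :
    cstarMatrixNorm M.conjTranspose = cstarMatrixNorm M := by
  let _ : PartialOrder C := CStarAlgebra.spectralOrder C
  let _ : StarOrderedRing C := CStarAlgebra.spectralOrderedRing C
  exact norm_star (CStarMatrix.ofMatrix M)

theorem cstarMatrixNorm_map {n : Type} [Fintype n] {Φ : C →⋆ₙₐ[ℂ] C} (hΦ : Function.Injective Φ)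
    (M : Matrix n n C) : cstarMatrixNorm (M.map Φ) = cstarMatrixNorm M := by
  let _ : PartialOrder C := CStarAlgebra.spectralOrder C
  let _ : StarOrderedRing C := CStarAlgebra.spectralOrderedRing C
  refine NonUnitalStarAlgHom.norm_map (CStarMatrix.mapₙₐ (n := n) Φ) ?_ (CStarMatrix.ofMatrix M)
  intro M N h
  ext i j
  exact hΦ (congrFun (congrFun h i) j)

variable {V : Type*}

/-- If `ρ (a*) = (Φ (ρ a))*` for an injective `*`-homomorphism `Φ`, then the involution is a
complete anti-isometry. -/
theorem isCompleteAntiIsometry_of_starHom [Star V] {ρ : V → C} (Φ : C →⋆ₙₐ[ℂ] C)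
    (hΦ : Function.Injective Φ) (h : ∀ a, ρ (star a) = star (Φ (ρ a))) :
    IsCompleteAntiIsometry ρ := by
  intro N x
  have hx : x.conjTranspose.map ρ = ((x.map ρ).map Φ).conjTranspose := by
    ext1 i j
    exact h (x j i)
  rw [opNorm, hx, cstarMatrixNorm_conjTranspose, cstarMatrixNorm_map hΦ, opNorm]

open Matrix in
-- The set whose infimum defines the Haagerup norm must be nonempty, since a lower bound on `sInf`
-- needs this. Factorizations of matrices with one elementary tensor entry are added by
-- concatenating columns and rows.
theorem exists_haagerup_factorization [AddCommGroup V] [Module ℂ V] {N : ℕ}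
    (z : Matrix (Fin N) (Fin N) (V ⊗[ℂ] V)) :
    ∃ (r : ℕ) (x : Matrix (Fin N) (Fin r) V) (y : Matrix (Fin r) (Fin N) V),
      ∀ i j, z i j = ∑ k, x i k ⊗ₜ[ℂ] y k j := by
  have hadd : ∀ z w : Matrix (Fin N) (Fin N) (V ⊗[ℂ] V),
      (∃ (r : ℕ) (x : Matrix (Fin N) (Fin r) V) (y : Matrix (Fin r) (Fin N) V),
        ∀ i j, z i j = ∑ k, x i k ⊗ₜ[ℂ] y k j) →
      (∃ (r : ℕ) (x : Matrix (Fin N) (Fin r) V) (y : Matrix (Fin r) (Fin N) V),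
        ∀ i j, w i j = ∑ k, x i k ⊗ₜ[ℂ] y k j) →
      ∃ (r : ℕ) (x : Matrix (Fin N) (Fin r) V) (y : Matrix (Fin r) (Fin N) V),
        ∀ i j, (z + w) i j = ∑ k, x i k ⊗ₜ[ℂ] y k j := by
    rintro z w ⟨r, x, y, h⟩ ⟨r', x', y', h'⟩
    refine ⟨r + r', fun i => Fin.append (x i) (x' i),
      fun k j => Fin.append (fun k => y k j) (fun k => y' k j) k, fun i j => ?_⟩
    simp [Fin.sum_univ_add, h, h']
  have hzero : ∃ (r : ℕ) (x : Matrix (Fin N) (Fin r) V) (y : Matrix (Fin r) (Fin N) V),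
        ∀ i j, (0 : Matrix (Fin N) (Fin N) (V ⊗[ℂ] V)) i j = ∑ k, x i k ⊗ₜ[ℂ] y k j :=
    ⟨0, 0, 0, fun i j => by simp⟩
  have hsingle : ∀ (i j : Fin N) (t : V ⊗[ℂ] V),
      ∃ (r : ℕ) (x : Matrix (Fin N) (Fin r) V) (y : Matrix (Fin r) (Fin N) V),
        ∀ i' j', Matrix.single i j t i' j' = ∑ k, x i' k ⊗ₜ[ℂ] y k j' := by
    intro i j t
    induction t using TensorProduct.induction_on with
    | zero => simpa using hzero
    | tmul a b =>
      refine ⟨1, Matrix.single i 0 a, Matrix.single 0 j b, fun i' j' => ?_⟩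
      by_cases hi : i = i' <;> by_cases hj : j = j' <;> simp [Matrix.single_apply, hi, hj]
    | add s t hs ht =>
      rw [Matrix.single_add]
      exact hadd _ _ hs ht
  rw [Matrix.matrix_eq_sum_single z]
  refine Finset.sum_induction _ _ hadd hzero fun i _ => ?_
  exact Finset.sum_induction _ _ hadd hzero fun j _ => hsingle i j _

/-- An algebra homomorphism makes the multiplication completely contractive for the Haagerup
norms. -/
theorem opNorm_map_mul'_le_haagerupNorm [NonUnitalRing V] [Module ℂ V] [IsScalarTower ℂ V V]
    [SMulCommClass ℂ V V] (ρ : V →ₙₐ[ℂ] C) {N : ℕ} (z : Matrix (Fin N) (Fin N) (V ⊗[ℂ] V)) :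
    opNorm (ρ : V →ₗ[ℂ] C) (z.map (LinearMap.mul' ℂ V)) ≤ haagerupNorm (ρ : V →ₗ[ℂ] C) z := by
  refine le_csInf ?_ ?_
  · obtain ⟨r, x, y, h⟩ := exists_haagerup_factorization z
    exact ⟨_, r, x, y, h, rfl⟩
  · rintro c ⟨r, x, y, h, rfl⟩
    have hz : (z.map (LinearMap.mul' ℂ V)).map (ρ : V →ₗ[ℂ] C) =
        x.map (ρ : V →ₗ[ℂ] C) * y.map (ρ : V →ₗ[ℂ] C) := by
      ext1 i j
      simp [Matrix.mul_apply, h]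
    rw [opNorm, hz]
    exact cstarMatrixNorm_mul_le _ _

end MatrixNorms

/-! ### The Sobolev subalgebras as involutive operator algebras. -/

namespace UnboundedBimodule

variable {A B E : Type*} [NonUnitalCStarAlgebra A] [NonUnitalCStarAlgebra B]
  [PartialOrder B] [StarOrderedRing B] [NormedAddCommGroup E] [NormedSpace ℂ E] [CompleteSpace E]
  [SMul B E] [CStarModule B E] (X : UnboundedBimodule A B E)

/-- The `n`-th Sobolev subalgebra. -/
def sobolevSubalgebra (n : ℕ) : NonUnitalStarSubalgebra ℂ A where
  carrier := X.sobolev n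
  add_mem' := (X.isGradedRep_rep n).add_mem
  zero_mem' := (X.isGradedRep_rep n).zero_mem
  mul_mem' := (X.isGradedRep_rep n).mul_mem
  smul_mem' c _ := (X.isGradedRep_rep n).smul_mem c
  star_mem' := (X.isGradedRep_rep n).star_mem

theorem mem_sobolev_of_le {n : ℕ} (a : X.sobolevSubalgebra n) (j : Fin (n + 1)) :
    (a : A) ∈ X.sobolev j :=
  X.sobolev_antitone (Nat.lt_succ_iff.1 j.2) a.2

/-- The representation `⊕_{j ≤ n} π_j` of the `n`-th Sobolev subalgebra. -/
def sobolevRep (n : ℕ) : X.sobolevSubalgebra n →ₙₐ[ℂ] SobolevTarget B E n where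
  toFun a := X.sumRep n a
  map_smul' c a := by
    funext j
    exact (X.isGradedRep_rep j).map_smul c (X.mem_sobolev_of_le a j)
  map_zero' := by
    funext j
    have h := (X.isGradedRep_rep j).map_smul 0 (X.isGradedRep_rep j).zero_mem
    rw [zero_smul, zero_smul] at h
    exact h
  map_add' a b := by
    funext j
    exact (X.isGradedRep_rep j).map_add (X.mem_sobolev_of_le a j) (X.mem_sobolev_of_le b j)
  map_mul' a b := by
    funext j
    exact (X.isGradedRep_rep j).map_mul (X.mem_sobolev_of_le a j) (X.mem_sobolev_of_le b j)

/-- The automorphism `⊕_{j ≤ n} Ψ_j` of `⊕_{j ≤ n} End*_B(E_j)`. -/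
def starAutSum (n : ℕ) : SobolevTarget B E n →⋆ₙₐ[ℂ] SobolevTarget B E n where
  toFun M j := CStarMatrix.ofMatrix (X.starAut j (CStarMatrix.ofMatrix.symm (M j)))
  map_smul' c M := by
    funext j
    exact map_smul (X.starAut j) c (CStarMatrix.ofMatrix.symm (M j))
  map_zero' := by
    funext j
    exact map_zero (X.starAut j)
  map_add' M N := by
    funext j
    exact map_add (X.starAut j) (CStarMatrix.ofMatrix.symm (M j)) (CStarMatrix.ofMatrix.symm (N j))
  map_mul' M N := by
    funext j
    exact map_mul (X.starAut j) (CStarMatrix.ofMatrix.symm (M j)) (CStarMatrix.ofMatrix.symm (N j))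
  map_star' M := by
    funext j
    exact map_star (X.starAut j) (CStarMatrix.ofMatrix.symm (M j))

theorem starAutSum_injective (n : ℕ) :
    Function.Injective (X.starAutSum (A := A) (B := B) (E := E) n) := by
  intro M N h
  funext j
  exact X.starAut_injective j (congrFun h j)

theorem sobolevRep_star (n : ℕ) (a : X.sobolevSubalgebra n) :
    X.sobolevRep n (star a) = star (X.starAutSum n (X.sobolevRep n a)) := by
  funext j
  exact (X.isGradedRep_rep j).map_star (X.mem_sobolev_of_le a j)

theorem sobolevRep_injective (hφ : Function.Injective X.φ) (n : ℕ) :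
    Function.Injective (X.sobolevRep n) := by
  intro a b h
  have h0 : X.rep 0 a = X.rep 0 b := congrFun h 0
  exact Subtype.ext (hφ (congrFun (congrFun h0 ()) ()))

theorem isClosed_range_sobolevRep (hφ : Function.Injective X.φ) (n : ℕ) :
    IsClosed (Set.range (X.sobolevRep n)) := by
  refine IsSeqClosed.isClosed fun u T hu hT => ?_
  choose a ha using hu
  have hj : ∀ j : Fin (n + 1), Filter.Tendsto (fun k => X.rep j (a k)) Filter.atTop
      (nhds (CStarMatrix.ofMatrix.symm (T j))) := by
    intro j
    have h := (tendsto_pi_nhds.1 hT) j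
    simp only [← ha] at h
    exact h
  have h0 : Filter.Tendsto (fun k => X.φ (a k)) Filter.atTop (nhds (T 0 () ())) :=
    ((hj 0).apply_nhds ()).apply_nhds ()
  -- An injective `φ` is isometric, so convergence of the component `π_0` already produces the limit
  -- `b` in `A`.
  have hφi : Isometry X.φ :=
    AddMonoidHomClass.isometry_of_norm X.φ (NonUnitalStarAlgHom.norm_map X.φ hφ)
  have hcau : CauchySeq fun k => (a k : A) := by
    have := h0.cauchySeq
    exact hφi.isUniformInducing.cauchy_map_iff.1 (by rwa [Filter.map_map])
  obtain ⟨b, hb⟩ := cauchySeq_tendsto_of_complete hcau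
  have hb0 : Filter.Tendsto (fun k => X.rep 0 (a k)) Filter.atTop (nhds (X.rep 0 b)) := by
    refine tendsto_pi_nhds.2 fun _ => tendsto_pi_nhds.2 fun _ => ?_
    exact (hφi.continuous.tendsto b).comp hb
  obtain ⟨hbn, hrep⟩ := X.mem_sobolev_of_tendsto n (fun k => (a k).2) hb0
    -- The family is needed for all `j : ℕ`; the value `0` beyond `n` plays no role.
    (fun j => if h : j < n + 1 then CStarMatrix.ofMatrix.symm (T ⟨j, h⟩) else 0) fun j hjn => by
      have h : j < n + 1 := Nat.lt_succ_iff.2 hjn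
      simpa only [h, dif_pos] using hj ⟨j, h⟩
  refine ⟨⟨b, hbn⟩, ?_⟩
  funext j
  have := hrep j (Nat.lt_succ_iff.1 j.2)
  simp only [j.2, dif_pos] at this
  exact this

end UnboundedBimodule

end

theorem mainTheorem9 {A B E : Type*} [NonUnitalCStarAlgebra A] [NonUnitalCStarAlgebra B]
    [PartialOrder B] [StarOrderedRing B] [NormedAddCommGroup E] [NormedSpace ℂ E] [CompleteSpace E]
    [SMul B E] [CStarModule B E] (X : UnboundedBimodule A B E) (n : ℕ) :
    ∃ (S : NonUnitalStarSubalgebra ℂ A)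
      (ρ : S →ₙₐ[ℂ] UnboundedBimodule.SobolevTarget B E n),
      (S : Set A) = X.sobolev n ∧
      (∀ a : S, ρ a = X.sumRep n (a : A)) ∧
      IsCompleteAntiIsometry ρ ∧
      (Function.Injective X.φ → IsInvolutiveOperatorAlgebra (ρ : S →ₗ[ℂ] UnboundedBimodule.SobolevTarget B E n)) := by
  have h := isCompleteAntiIsometry_of_starHom (X.starAutSum n) (X.starAutSum_injective n)
    (X.sobolevRep_star n)
  exact ⟨X.sobolevSubalgebra n, X.sobolevRep n, rfl, fun _ => rfl, h, fun hφ =>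
    ⟨⟨⟨X.sobolevRep_injective hφ n, X.isClosed_range_sobolevRep hφ n⟩,
      fun _ z => opNorm_map_mul'_le_haagerupNorm (X.sobolevRep n) z⟩,
      -- A complete anti-isometry is completely bounded with constant `1`.
      1, fun N x => (h N x).le.trans (one_mul _).ge⟩⟩
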